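/- All graphs are finite, simple and undirected. A magic unitary over a unital $C^*$-algebra is a matrix $U=(u_{xy})_{x\in V,\,y\in W}$ ($V,W$ finite) whose entries are projections ($u_{xy}=u_{xy}^*=u_{xy}^2$) with $\sum_{y}u_{xy}=1$ for every $x$ and $\sum_{x}u_{xy}=1$ for every $y$. Graphs $X$ and $Y$ with adjacency matrices $A$ and $B$ are quantum isomorphic if there are a nonzero complex Hilbert space $\mathcal H$ and a magic unitary $U=(u_{xy})_{x\in V(X),\,y\in V(Y)}$ with entries in $\mathcal B(\mathcal H)$ such that $AU=UB$. A coherent algebra on a finite set $V$ is a unital self-adjoint subalgebra of the algebra of complex $V\times V$ matrices that contains the all-ones matrix $J$ and is closed under the Schur (entrywise) product $\circ$; the coherent algebra (Weisfeiler–Leman closure) of a graph is the smallest coherent algebra that contains its adjacency matrix. An isomorphism $\Phi:\mathcal C\to\mathcal C'$ of coherent algebras is a linear bijection with $\Phi(MN)=\Phi(M)\Phi(N)$, $\Phi(M^*)=\Phi(M)^*$, $\Phi(M\circ N)=\Phi(M)\circ\Phi(N)$ for all $M,N\in\mathcal C$, $\Phi(I)=I$ and $\Phi(J)=J$. Graphs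 $X$ and $Y$ are equivalent if there is an isomorphism $\Phi$ from the coherent algebra of $X$ to that of $Y$ with $\Phi(A)=B$. If $X$ and $Y$ are quantum isomorphic graphs with adjacency matrices $A$ and $B$, then there exists an isomorphism $\Phi$ of their coherent algebras such that $\Phi(A)=B$; that is, $X$ and $Y$ are equivalent. Moreover, this necessary condition is testable in polynomial time: there are a program for a random access machine (with addition and truncated subtraction of natural numbers, indirect addressing and tests for zero, each executed instruction and test counting as one step) and a polynomial $p$ such that, for all graphs $X$ on $\{0,\dots,n-1\}$ and $Y$ on $\{0,\dots,m-1\}$, given $n$, $m$ and the two adjacency matrices, the program halts after at most $p(n+m)$ steps and outputs $1$ if $X$ and $Y$ are equivalent and $0$ otherwise. -/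

import Mathlib

open scoped Matrix

universe u v w

noncomputable section

namespace QIso

/-! ### Quantum isomorphism -/

/-- The complex adjacency matrix of a simple graph. -/
def adj {V : Type*} (X : SimpleGraph V) : Matrix V V ℂ :=
  open Classical in X.adjMatrix ℂ

/-- A matrix over a unital star ring is a magic unitary if all entries are (self-adjoint)
projections and every row and every column sums to `1`. -/
structure IsMagicUnitary {V W R : Type*} [Fintype V] [Fintype W] [Ring R] [StarRing R]
    (U : Matrix V W R) : Prop where
  isStarProjection : ∀ x y, IsStarProjection (U x y)
  row_sum : ∀ x, ∑ y, U x y = 1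
  col_sum : ∀ y, ∑ x, U x y = 1

/-- `X` and `Y` are quantum isomorphic: for some (nonzero, complex) Hilbert space `H` there is a
magic unitary `U` with entries in `B(H)` such that `A U = U B`. Complex matrices act on matrices
over `B(H)` through the embedding of the scalars in `B(H)`. -/
def QuantumIsomorphic {V : Type u} {W : Type v} [Fintype V] [Fintype W]
    (X : SimpleGraph V) (Y : SimpleGraph W) : Prop :=
  ∃ (H : Type w) (_ : NormedAddCommGroup H) (_ : InnerProductSpace ℂ H) (_ : CompleteSpace H)
    (_ : Nontrivial H) (U : Matrix V W (H →L[ℂ] H)),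
    IsMagicUnitary U ∧
      (adj X).map (algebraMap ℂ (H →L[ℂ] H)) * U = U * (adj Y).map (algebraMap ℂ (H →L[ℂ] H))

/-! ### Coherent algebras -/

/-- The all-ones matrix `J`. -/
def allOnes (V : Type*) : Matrix V V ℂ := Matrix.of fun _ _ => 1

/-- A coherent algebra on `V`: a unital, self-adjoint algebra of complex `V × V` matrices that
contains the all-ones matrix and is closed under the Schur (entrywise) product. -/
structure CoherentAlgebra (V : Type*) [Fintype V] [DecidableEq V] extends
    StarSubalgebra ℂ (Matrix V V ℂ) where
  allOnes_mem' : allOnes V ∈ carrier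
  schur_mem' : ∀ {M N : Matrix V V ℂ}, M ∈ carrier → N ∈ carrier → M ⊙ N ∈ carrier

namespace CoherentAlgebra

variable {V W : Type*} [Fintype V] [DecidableEq V] [Fintype W] [DecidableEq W]

/-- The algebra of matrices underlying a coherent algebra, as a type. -/
abbrev Elem (C : CoherentAlgebra V) : Type _ := C.toStarSubalgebra

/-- The all-ones matrix as an element of a coherent algebra. -/
def J (C : CoherentAlgebra V) : C.Elem := ⟨allOnes V, C.allOnes_mem'⟩

/-- The Schur product of two elements of a coherent algebra. -/
def schur (C : CoherentAlgebra V) (M N : C.Elem) : C.Elem :=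
  ⟨(M : Matrix V V ℂ) ⊙ (N : Matrix V V ℂ), C.schur_mem' M.2 N.2⟩

/-- An isomorphism of coherent algebras: a linear bijection that preserves matrix products,
adjoints and Schur products, and maps `I` to `I` and `J` to `J`. -/
structure Iso (C : CoherentAlgebra V) (D : CoherentAlgebra W) where
  toEquiv : C.Elem ≃ₗ[ℂ] D.Elem
  map_mul : ∀ M N, toEquiv (M * N) = toEquiv M * toEquiv N
  map_star : ∀ M, toEquiv (star M) = star (toEquiv M)
  map_schur : ∀ M N, toEquiv (C.schur M N) = D.schur (toEquiv M) (toEquiv N)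
  map_one : toEquiv 1 = 1
  map_J : toEquiv C.J = D.J

/-- The coherent algebra of a graph: the intersection of all coherent algebras containing its
adjacency matrix. -/
def ofGraph (X : SimpleGraph V) : CoherentAlgebra V where
  toStarSubalgebra :=
    sInf {S | ∃ C : CoherentAlgebra V, C.toStarSubalgebra = S ∧ adj X ∈ S}
  allOnes_mem' := by
    change allOnes V ∈ (sInf _ : StarSubalgebra ℂ (Matrix V V ℂ))
    rw [StarSubalgebra.mem_sInf]
    rintro _ ⟨C, rfl, -⟩
    exact C.allOnes_mem'
  schur_mem' := by
    intro M N hM hN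
    change M ∈ (sInf _ : StarSubalgebra ℂ (Matrix V V ℂ)) at hM
    change N ∈ (sInf _ : StarSubalgebra ℂ (Matrix V V ℂ)) at hN
    change M ⊙ N ∈ (sInf _ : StarSubalgebra ℂ (Matrix V V ℂ))
    rw [StarSubalgebra.mem_sInf] at *
    rintro _ ⟨C, rfl, h⟩
    exact C.schur_mem' (hM _ ⟨C, rfl, h⟩) (hN _ ⟨C, rfl, h⟩)

theorem adj_mem_ofGraph (X : SimpleGraph V) : adj X ∈ (ofGraph X).toStarSubalgebra := by
  change adj X ∈ sInf _
  rw [StarSubalgebra.mem_sInf]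
  rintro _ ⟨C, rfl, h⟩
  exact h

/-- The coherent algebra of `X` is the smallest one that contains the adjacency matrix. -/
theorem ofGraph_le (X : SimpleGraph V) (C : CoherentAlgebra V) (h : adj X ∈ C.toStarSubalgebra) :
    (ofGraph X).toStarSubalgebra ≤ C.toStarSubalgebra :=
  sInf_le ⟨C, rfl, h⟩

/-- The adjacency matrix as an element of the coherent algebra of the graph. -/
def adjElem (X : SimpleGraph V) : (ofGraph X).Elem := ⟨adj X, adj_mem_ofGraph X⟩

end CoherentAlgebra

/-- Two graphs are equivalent if some isomorphism of their coherent algebras maps the adjacency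
matrix of the first to that of the second. -/
def GraphEquivalent {V W : Type*} [Fintype V] [DecidableEq V] [Fintype W] [DecidableEq W]
    (X : SimpleGraph V) (Y : SimpleGraph W) : Prop :=
  ∃ Φ : (CoherentAlgebra.ofGraph X).Iso (CoherentAlgebra.ofGraph Y),
    Φ.toEquiv (CoherentAlgebra.adjElem X) = CoherentAlgebra.adjElem Y

/-! ### Polynomial time on a random access machine -/

/-- The configuration of the memory of a random access machine: registers, and a memory that is
accessed indirectly, all holding natural numbers. -/
structure RamState where
  reg : ℕ → ℕ
  mem : ℕ → ℕ

namespace RamState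

/-- Overwrite a register. -/
def setReg (s : RamState) (r v : ℕ) : RamState := { s with reg := Function.update s.reg r v }

/-- Overwrite a memory cell. -/
def setMem (s : RamState) (a v : ℕ) : RamState := { s with mem := Function.update s.mem a v }

end RamState

/-- Programs of a random access machine. The arithmetic instructions are addition and truncated
subtraction only (no multiplication), so that counting every instruction as one step yields the
usual polynomial time: in `t` steps a number can grow at most by a factor `2 ^ t`. -/
inductive RamProg where
  /-- `r := c` -/
  | const (r c : ℕ)
  /-- `r := a + b` -/
  | add (r a b : ℕ)
  /-- `r := a - b` -/
  | sub (r a b : ℕ)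
  /-- `r := mem[a]` -/
  | load (r a : ℕ)
  /-- `mem[a] := b` -/
  | store (a b : ℕ)
  | seq (P Q : RamProg)
  /-- if register `r` is nonzero then `P` else `Q` -/
  | cond (r : ℕ) (P Q : RamProg)
  /-- while register `r` is nonzero do `P` -/
  | loop (r : ℕ) (P : RamProg)

/-- `Runs P s t s'`: started in `s`, the program `P` halts in `s'` after exactly `t` steps.
Every instruction and every evaluation of a test is one step. -/
inductive Runs : RamProg → RamState → ℕ → RamState → Prop where
  | const (r c : ℕ) (s : RamState) : Runs (.const r c) s 1 (s.setReg r c)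
  | add (r a b : ℕ) (s : RamState) : Runs (.add r a b) s 1 (s.setReg r (s.reg a + s.reg b))
  | sub (r a b : ℕ) (s : RamState) : Runs (.sub r a b) s 1 (s.setReg r (s.reg a - s.reg b))
  | load (r a : ℕ) (s : RamState) : Runs (.load r a) s 1 (s.setReg r (s.mem (s.reg a)))
  | store (a b : ℕ) (s : RamState) : Runs (.store a b) s 1 (s.setMem (s.reg a) (s.reg b))
  | seq {P Q : RamProg} {s₁ s₂ s₃ : RamState} {t₁ t₂ : ℕ} :
      Runs P s₁ t₁ s₂ → Runs Q s₂ t₂ s₃ → Runs (.seq P Q) s₁ (t₁ + t₂) s₃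
  | cond_true {r : ℕ} {P Q : RamProg} {s s' : RamState} {t : ℕ} :
      s.reg r ≠ 0 → Runs P s t s' → Runs (.cond r P Q) s (t + 1) s'
  | cond_false {r : ℕ} {P Q : RamProg} {s s' : RamState} {t : ℕ} :
      s.reg r = 0 → Runs Q s t s' → Runs (.cond r P Q) s (t + 1) s'
  | loop_false {r : ℕ} {P : RamProg} {s : RamState} :
      s.reg r = 0 → Runs (.loop r P) s 1 s
  | loop_true {r : ℕ} {P : RamProg} {s₁ s₂ s₃ : RamState} {t₁ t₂ : ℕ} :
      s₁.reg r ≠ 0 → Runs P s₁ t₁ s₂ → Runs (.loop r P) s₂ t₂ s₃ →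
        Runs (.loop r P) s₁ (t₁ + t₂ + 1) s₃

/-- The initial state for the input `(X, Y)`. Registers `0` and `1` hold the numbers `n` and `m` of
vertices and the others hold `0`; the memory holds the `n * n` entries of the adjacency matrix
of `X`, row by row, then the `m * m` entries of that of `Y`, and `0` elsewhere. -/
def inputState {n m : ℕ} (X : SimpleGraph (Fin n)) (Y : SimpleGraph (Fin m)) : RamState where
  reg r := if r = 0 then n else if r = 1 then m else 0
  mem k := open Classical in
    if (∃ i j : Fin n, k = (i : ℕ) * n + (j : ℕ) ∧ X.Adj i j) ∨
      (∃ i j : Fin m, k = n * n + ((i : ℕ) * m + (j : ℕ)) ∧ Y.Adj i j) then 1 else 0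

/-- A relation between finite graphs is decidable in polynomial time: one program and one polynomial
serve for all pairs of graphs, the program halts within the polynomial of the number of vertices,
and then register `0` holds `1` if the relation holds, and `0` if not. -/
def PolyTimeDecidable
    (R : ∀ {n m : ℕ}, SimpleGraph (Fin n) → SimpleGraph (Fin m) → Prop) : Prop :=
  ∃ (P : RamProg) (p : Polynomial ℕ), ∀ (n m : ℕ) (X : SimpleGraph (Fin n))
    (Y : SimpleGraph (Fin m)), ∃ (t : ℕ) (s : RamState),
      Runs P (inputState X Y) t s ∧ t ≤ p.eval (n + m) ∧
        (R X Y → s.reg 0 = 1) ∧ (¬ R X Y → s.reg 0 = 0)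

end QIso

end

/-! Quantum isomorphism. Compress the equation `A U = U B`, and more generally `M U = U N`, between
`U x y` and `U x' y'`. Entries in one row or one column are orthogonal, so the equation says exactly
that `M x x' = N y y'` whenever `U x y * U x' y' ≠ 0` (`IsMagicUnitary.intertwines_iff_eq`). The
intertwined pairs `(M, N)` therefore form a star algebra that is also closed under Schur products
and contains `(J, J)` and `(A, B)`. Each pair `(x, x')` meets some `(y, y')` with nonzero product
and conversely, so either component of an intertwined pair determines the other. Such an algebra of
pairs, cut down to the two coherent algebras, is the graph of an isomorphism by their minimality
(`graphEquivalent_of_starSubalgebra`).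

Decidability. Equivalence is decided by two-dimensional Weisfeiler-Leman refinement run on both
graphs at once with common colours. An isomorphism of coherent algebras carries the colour matrix of
one graph to that of the other in every round, since indicators of colours are Schur polynomials and
counts of coloured paths are matrix products; hence every colour of the second graph occurs in the
first. Conversely, once the colouring is stable, the pairs of matrices whose entries depend only on
colours form an algebra as above, and one shared colour already forces all colours to be shared. So
it suffices to look for the colour of a single cell of the second graph in the first.

Complexity. With `L = 2 n²` cells, `L` rounds suffice. Colours are never renamed: a new colour is
the old one followed by all the counts as digits in base `n + 1`. The numbers become huge, but they
are built by polynomially many additions, each of which is one step of the machine. -/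

namespace QIso

/-! ### Isomorphisms of coherent algebras from algebras of pairs -/

section Equivalence

open CoherentAlgebra

variable {V : Type u} {W : Type v} [Fintype V] [DecidableEq V] [Fintype W] [DecidableEq W]

/-- A star subalgebra of pairs of matrices, closed under Schur products, that contains the pair of
all-ones matrices and the pair of adjacency matrices, and whose two projections are injective,
induces an equivalence of graphs. -/
theorem graphEquivalent_of_starSubalgebra {X : SimpleGraph V} {Y : SimpleGraph W}
    (S : StarSubalgebra ℂ (Matrix V V ℂ × Matrix W W ℂ))
    (hJ : (allOnes V, allOnes W) ∈ S)
    (hschur : ∀ p ∈ S, ∀ q ∈ S, (p.1 ⊙ q.1, p.2 ⊙ q.2) ∈ S)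
    (hA : (adj X, adj Y) ∈ S)
    (hl : ∀ p ∈ S, p.1 = 0 → p.2 = 0) (hr : ∀ p ∈ S, p.2 = 0 → p.1 = 0) :
    GraphEquivalent X Y := by
  let T : StarSubalgebra ℂ (Matrix V V ℂ × Matrix W W ℂ) :=
    S ⊓ ((ofGraph X).toStarSubalgebra.comap (StarAlgHom.fst ℂ _ _) ⊓
      (ofGraph Y).toStarSubalgebra.comap (StarAlgHom.snd ℂ _ _))
  have hT : ∀ p, p ∈ T ↔ p ∈ S ∧ p.1 ∈ (ofGraph X).toStarSubalgebra ∧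
      p.2 ∈ (ofGraph Y).toStarSubalgebra := fun p => Iff.rfl
  have hTJ : (allOnes V, allOnes W) ∈ T :=
    (hT _).2 ⟨hJ, (ofGraph X).allOnes_mem', (ofGraph Y).allOnes_mem'⟩
  have hTA : (adj X, adj Y) ∈ T :=
    (hT _).2 ⟨hA, adj_mem_ofGraph X, adj_mem_ofGraph Y⟩
  have hTs : ∀ p ∈ T, ∀ q ∈ T, (p.1 ⊙ q.1, p.2 ⊙ q.2) ∈ T := fun p hp q hq =>
    (hT _).2 ⟨hschur p hp.1 q hq.1, (ofGraph X).schur_mem' hp.2.1 hq.2.1,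
      (ofGraph Y).schur_mem' hp.2.2 hq.2.2⟩
  -- The components of `T` on either side form a coherent algebra containing the adjacency matrix,
  -- so by minimality they exhaust the coherent algebra of the graph. Both projections of `T` are
  -- then bijective, and the isomorphism is one projection after the inverse of the other.
  let CX : CoherentAlgebra V :=
    { T.map (StarAlgHom.fst ℂ _ _) with
      allOnes_mem' := ⟨_, hTJ, rfl⟩
      schur_mem' := by
        rintro _ _ ⟨p, hp, rfl⟩ ⟨q, hq, rfl⟩
        exact ⟨_, hTs p hp q hq, rfl⟩ }
  let CY : CoherentAlgebra W :=
    { T.map (StarAlgHom.snd ℂ _ _) with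
      allOnes_mem' := ⟨_, hTJ, rfl⟩
      schur_mem' := by
        rintro _ _ ⟨p, hp, rfl⟩ ⟨q, hq, rfl⟩
        exact ⟨_, hTs p hp q hq, rfl⟩ }
  have hX : ∀ M ∈ (ofGraph X).toStarSubalgebra, ∃ p ∈ T, p.1 = M := fun M hM =>
    ofGraph_le X CX ⟨_, hTA, rfl⟩ hM
  have hY : ∀ M ∈ (ofGraph Y).toStarSubalgebra, ∃ p ∈ T, p.2 = M := fun M hM =>
    ofGraph_le Y CY ⟨_, hTA, rfl⟩ hM
  let f : T →ₗ[ℂ] (ofGraph X).Elem :=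
    { toFun := fun p => ⟨p.1.1, p.2.2.1⟩
      map_add' := fun _ _ => rfl
      map_smul' := fun _ _ => rfl }
  let g : T →ₗ[ℂ] (ofGraph Y).Elem :=
    { toFun := fun p => ⟨p.1.2, p.2.2.2⟩
      map_add' := fun _ _ => rfl
      map_smul' := fun _ _ => rfl }
  have hf : Function.Bijective f := by
    constructor
    · rw [injective_iff_map_eq_zero]
      rintro ⟨p, hp⟩ h
      have h1 : p.1 = 0 := congrArg Subtype.val h
      exact Subtype.ext (Prod.ext h1 (hl p hp.1 h1))
    · rintro ⟨M, hM⟩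
      obtain ⟨p, hp, rfl⟩ := hX M hM
      exact ⟨⟨p, hp⟩, rfl⟩
  have hg : Function.Bijective g := by
    constructor
    · rw [injective_iff_map_eq_zero]
      rintro ⟨p, hp⟩ h
      have h1 : p.2 = 0 := congrArg Subtype.val h
      exact Subtype.ext (Prod.ext (hr p hp.1 h1) h1)
    · rintro ⟨M, hM⟩
      obtain ⟨p, hp, rfl⟩ := hY M hM
      exact ⟨⟨p, hp⟩, rfl⟩
  let e := (LinearEquiv.ofBijective f hf).symm.trans (LinearEquiv.ofBijective g hg)
  have he : ∀ t : T, e (f t) = g t := fun t => by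
    have h : (LinearEquiv.ofBijective f hf).symm (f t) = t :=
      (LinearEquiv.ofBijective f hf).symm_apply_apply t
    change g ((LinearEquiv.ofBijective f hf).symm (f t)) = g t
    rw [h]
  refine ⟨{ toEquiv := e, map_mul := ?_, map_star := ?_, map_schur := ?_, map_one := ?_,
            map_J := ?_ }, ?_⟩
  · intro M N
    obtain ⟨s, rfl⟩ := hf.2 M
    obtain ⟨t, rfl⟩ := hf.2 N
    rw [he, he]
    exact he (s * t)
  · intro M
    obtain ⟨s, rfl⟩ := hf.2 M
    rw [he]
    exact he (star s)
  · intro M N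
    obtain ⟨s, rfl⟩ := hf.2 M
    obtain ⟨t, rfl⟩ := hf.2 N
    rw [he, he]
    exact he ⟨_, hTs s.1 s.2 t.1 t.2⟩
  · exact he 1
  · exact he ⟨_, hTJ⟩
  · exact he ⟨_, hTA⟩

end Equivalence

/-! ### Intertwiners of a magic unitary -/

section Quantum

variable {V : Type u} {W : Type v} [Fintype V] [Fintype W]
  {H : Type w} [NormedAddCommGroup H] [InnerProductSpace ℂ H] [CompleteSpace H]

/-- Projections on a Hilbert space that sum to the identity are pairwise orthogonal. -/
theorem mul_eq_zero_of_sum_eq_one {ι : Type*} [Fintype ι] {p : ι → H →L[ℂ] H}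
    (hp : ∀ i, IsStarProjection (p i)) (hsum : ∑ i, p i = 1) {i j : ι} (hij : i ≠ j) :
    p i * p j = 0 := by
  classical
  have hnorm : ∀ k x, RCLike.re (inner ℂ x (p k x)) = ‖p k x‖ ^ 2 := by
    intro k x
    have h1 : p k (p k x) = p k x := by
      conv_rhs => rw [← (hp k).isIdempotentElem.eq]
      rfl
    have h2 : ContinuousLinearMap.adjoint (p k) = p k := (hp k).isSelfAdjoint
    rw [← h1, ← ContinuousLinearMap.adjoint_inner_left, h2, h1]
    exact inner_self_eq_norm_sq _
  have hall : ∀ x, ∑ k, ‖p k x‖ ^ 2 = ‖x‖ ^ 2 := by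
    intro x
    rw [← inner_self_eq_norm_sq (𝕜 := ℂ) x]
    have hx : x = ∑ k, p k x := by
      rw [← _root_.sum_apply, hsum]; rfl
    conv_rhs => rw [hx]
    conv_rhs => rw [inner_sum]
    rw [map_sum]
    refine Finset.sum_congr rfl fun k _ => ?_
    rw [← hx, hnorm]
  ext x
  have hj : p j (p j x) = p j x := by
    conv_rhs => rw [← (hp j).isIdempotentElem.eq]
    rfl
  -- On a vector in the range of `p j` the term for `j` is already the whole squared norm, so every
  -- other term vanishes.
  have h := hall (p j x)
  rw [← Finset.add_sum_erase _ _ (Finset.mem_univ j), hj] at h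
  have h0 : ∑ k ∈ Finset.univ.erase j, ‖p k (p j x)‖ ^ 2 = 0 := by linarith
  rw [Finset.sum_eq_zero_iff_of_nonneg fun _ _ => sq_nonneg _] at h0
  have := h0 i (Finset.mem_erase.2 ⟨hij, Finset.mem_univ _⟩)
  simpa using this

/-- Scalar matrices `M` and `N` are intertwined by a matrix over `B(H)`. -/
def Intertwines (U : Matrix V W (H →L[ℂ] H)) (M : Matrix V V ℂ) (N : Matrix W W ℂ) : Prop :=
  M.map (algebraMap ℂ (H →L[ℂ] H)) * U = U * N.map (algebraMap ℂ (H →L[ℂ] H))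

theorem intertwines_iff_sum {U : Matrix V W (H →L[ℂ] H)} {M : Matrix V V ℂ} {N : Matrix W W ℂ} :
    Intertwines U M N ↔ ∀ x y', ∑ x', M x x' • U x' y' = ∑ y, N y y' • U x y := by
  unfold Intertwines
  rw [← Matrix.ext_iff]
  refine forall_congr' fun x => forall_congr' fun y' => ?_
  simp only [Matrix.mul_apply, Matrix.map_apply]
  rw [Finset.sum_congr rfl fun x' _ => (Algebra.smul_def (M x x') (U x' y')).symm,
    Finset.sum_congr rfl fun y _ =>
      ((Algebra.smul_def (N y y') (U x y)).trans (Algebra.commutes _ _)).symm]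

/-- A magic unitary intertwines `M` and `N` iff it intertwines them entry by entry. -/
theorem IsMagicUnitary.intertwines_iff {U : Matrix V W (H →L[ℂ] H)} (hU : IsMagicUnitary U)
    {M : Matrix V V ℂ} {N : Matrix W W ℂ} :
    Intertwines U M N ↔
      ∀ x x' y y', M x x' • (U x y * U x' y') = N y y' • (U x y * U x' y') := by
  classical
  rw [intertwines_iff_sum]
  constructor
  -- Compress the `(x, y')` entry of the equation by `U x y` on the left and `U x' y'` on the right.
  -- Orthogonality in column `y'` leaves only the term `x'` of the left sum, and orthogonality in
  -- row `x` only the term `y` of the right sum.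
  · intro h x x' y y'
    have h1 := congrArg (fun T => U x y * T * U x' y') (h x y')
    simp only [Finset.mul_sum, Finset.sum_mul, mul_smul_comm, smul_mul_assoc] at h1
    rw [Finset.sum_eq_single x', Finset.sum_eq_single y] at h1
    · rwa [mul_assoc, (hU.isStarProjection x' y').isIdempotentElem.eq,
        (hU.isStarProjection x y).isIdempotentElem.eq] at h1
    · intro z _ hz
      rw [mul_eq_zero_of_sum_eq_one (fun k => hU.isStarProjection x k) (hU.row_sum x) hz.symm]
      simp
    · simp
    · intro z _ hz
      rw [mul_assoc,
        mul_eq_zero_of_sum_eq_one (fun k => hU.isStarProjection k y') (hU.col_sum y') hz]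
      simp
    · simp
  · intro h x y'
    calc ∑ x', M x x' • U x' y'
        = ∑ x', ∑ y, M x x' • (U x y * U x' y') := by
          refine Finset.sum_congr rfl fun x' _ => ?_
          rw [← Finset.smul_sum, ← Finset.sum_mul, hU.row_sum, one_mul]
      _ = ∑ x', ∑ y, N y y' • (U x y * U x' y') := by simp only [h]
      _ = ∑ y, ∑ x', N y y' • (U x y * U x' y') := Finset.sum_comm
      _ = ∑ y, N y y' • U x y := by
          refine Finset.sum_congr rfl fun y _ => ?_
          rw [← Finset.smul_sum, ← Finset.mul_sum, hU.col_sum, mul_one]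

/-- Otherwise the product of two row sums, which is `1`, would vanish. This and its mirror image
make each component of an intertwined pair determine the other. -/
theorem IsMagicUnitary.exists_ne_zero_left [Nontrivial H] {U : Matrix V W (H →L[ℂ] H)}
    (hU : IsMagicUnitary U) (x x' : V) : ∃ y y', U x y * U x' y' ≠ 0 := by
  by_contra! h
  have h1 : (∑ y, U x y) * ∑ y', U x' y' = 0 := by simp [Finset.sum_mul_sum, h]
  rw [hU.row_sum, hU.row_sum, one_mul] at h1
  exact one_ne_zero h1

theorem IsMagicUnitary.exists_ne_zero_right [Nontrivial H] {U : Matrix V W (H →L[ℂ] H)}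
    (hU : IsMagicUnitary U) (y y' : W) : ∃ x x', U x y * U x' y' ≠ 0 := by
  by_contra! h
  have h1 : (∑ x, U x y) * ∑ x', U x' y' = 0 := by simp [Finset.sum_mul_sum, h]
  rw [hU.col_sum, hU.col_sum, one_mul] at h1
  exact one_ne_zero h1

/-- In this form closure under Schur products is immediate, whereas closure under matrix products is
immediate from the intertwining equation itself. -/
theorem IsMagicUnitary.intertwines_iff_eq {U : Matrix V W (H →L[ℂ] H)} (hU : IsMagicUnitary U)
    {M : Matrix V V ℂ} {N : Matrix W W ℂ} :
    Intertwines U M N ↔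
      ∀ x x' y y', U x y * U x' y' ≠ 0 → M x x' = N y y' := by
  rw [hU.intertwines_iff]
  refine forall_congr' fun x => forall_congr' fun x' => forall_congr' fun y =>
    forall_congr' fun y' => ?_
  constructor
  · intro h hne
    exact smul_left_injective ℂ hne h
  · intro h
    by_cases hne : U x y * U x' y' = 0
    · simp [hne]
    · rw [h hne]

theorem IsMagicUnitary.mul_ne_zero_swap {U : Matrix V W (H →L[ℂ] H)} (hU : IsMagicUnitary U)
    {x x' : V} {y y' : W} (h : U x y * U x' y' ≠ 0) : U x' y' * U x y ≠ 0 := by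
  intro h0
  apply h
  have := congrArg star h0
  rwa [star_mul, star_zero, (hU.isStarProjection x y).isSelfAdjoint.star_eq,
    (hU.isStarProjection x' y').isSelfAdjoint.star_eq] at this

/-- The star algebra of the pairs of matrices that are intertwined by a magic unitary. -/
def IsMagicUnitary.intertwiners [DecidableEq V] [DecidableEq W]
    {U : Matrix V W (H →L[ℂ] H)} (hU : IsMagicUnitary U) :
    StarSubalgebra ℂ (Matrix V V ℂ × Matrix W W ℂ) where
  carrier := {p | Intertwines U p.1 p.2}
  mul_mem' := by
    rintro ⟨M, N⟩ ⟨M', N'⟩ h h'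
    change _ = _ at h
    change _ = _ at h'
    change _ = _
    simp only [Prod.mk_mul_mk, Matrix.map_mul] at *
    rw [Matrix.mul_assoc, h', ← Matrix.mul_assoc, h, Matrix.mul_assoc]
  add_mem' := by
    rintro p q hp hq
    change Intertwines _ _ _ at hp hq ⊢
    rw [hU.intertwines_iff_eq] at *
    intro x x' y y' h
    change p.1 x x' + q.1 x x' = p.2 y y' + q.2 y y'
    rw [hp _ _ _ _ h, hq _ _ _ _ h]
  algebraMap_mem' := by
    intro r
    change _ = _
    ext x y v
    simp [Matrix.mul_apply, Matrix.algebraMap_matrix_apply, apply_ite]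
  star_mem' := by
    rintro p hp
    change Intertwines _ _ _ at hp ⊢
    rw [hU.intertwines_iff_eq] at *
    intro x x' y y' h
    change star (p.1 x' x) = star (p.2 y' y)
    rw [hp _ _ _ _ (hU.mul_ne_zero_swap h)]

theorem graphEquivalent_of_quantumIsomorphic [DecidableEq V] [DecidableEq W]
    {X : SimpleGraph V} {Y : SimpleGraph W} (h : QuantumIsomorphic.{u, v, w} X Y) :
    GraphEquivalent X Y := by
  obtain ⟨H, _, _, _, _, U, hU, hUA⟩ := h
  have hmem : ∀ p, p ∈ hU.intertwiners ↔ ∀ x x' y y', U x y * U x' y' ≠ 0 → p.1 x x' = p.2 y y' :=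
    fun p => hU.intertwines_iff_eq
  refine graphEquivalent_of_starSubalgebra hU.intertwiners ?_ ?_ hUA ?_ ?_
  · rw [hmem]
    exact fun _ _ _ _ _ => rfl
  · intro p hp q hq
    rw [hmem] at *
    intro x x' y y' hne
    simp only [Matrix.hadamard_apply]
    rw [hp _ _ _ _ hne, hq _ _ _ _ hne]
  · intro p hp h0
    rw [hmem] at hp
    ext y y'
    obtain ⟨x, x', hne⟩ := hU.exists_ne_zero_right y y'
    rw [← hp _ _ _ _ hne, h0]; rfl
  · intro p hp h0
    rw [hmem] at hp
    ext x x'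
    obtain ⟨y, y', hne⟩ := hU.exists_ne_zero_left x x'
    rw [hp _ _ _ _ hne, h0]; rfl

end Quantum

/-! ### Matrices that correspond under an isomorphism -/

section Linked

open CoherentAlgebra

variable {V : Type u} {W : Type v} [Fintype V] [DecidableEq V] [Fintype W] [DecidableEq W]
  {C : CoherentAlgebra V} {D : CoherentAlgebra W} {Φ : C.Iso D}

/-- `M` and `N` are matrices that correspond to each other under `Φ`. -/
def CoherentAlgebra.Iso.Linked (Φ : C.Iso D) (M : Matrix V V ℂ) (N : Matrix W W ℂ) : Prop :=
  ∃ m : C.Elem, (m : Matrix V V ℂ) = M ∧ (Φ.toEquiv m : Matrix W W ℂ) = N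

namespace CoherentAlgebra.Iso.Linked

variable {M M' : Matrix V V ℂ} {N N' : Matrix W W ℂ}

theorem add (h : Φ.Linked M N) (h' : Φ.Linked M' N') : Φ.Linked (M + M') (N + N') := by
  obtain ⟨m, rfl, rfl⟩ := h
  obtain ⟨m', rfl, rfl⟩ := h'
  exact ⟨m + m', rfl, by rw [_root_.map_add]; rfl⟩

theorem smul (r : ℂ) (h : Φ.Linked M N) : Φ.Linked (r • M) (r • N) := by
  obtain ⟨m, rfl, rfl⟩ := h
  exact ⟨r • m, rfl, by rw [_root_.map_smul]; rfl⟩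

theorem mul (h : Φ.Linked M N) (h' : Φ.Linked M' N') : Φ.Linked (M * M') (N * N') := by
  obtain ⟨m, rfl, rfl⟩ := h
  obtain ⟨m', rfl, rfl⟩ := h'
  exact ⟨m * m', rfl, by rw [Φ.map_mul]; rfl⟩

theorem schur (h : Φ.Linked M N) (h' : Φ.Linked M' N') : Φ.Linked (M ⊙ M') (N ⊙ N') := by
  obtain ⟨m, rfl, rfl⟩ := h
  obtain ⟨m', rfl, rfl⟩ := h'
  exact ⟨C.schur m m', rfl, by rw [Φ.map_schur]; rfl⟩

variable (Φ) in
theorem one : Φ.Linked 1 1 := ⟨1, rfl, by rw [Φ.map_one]; rfl⟩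

variable (Φ) in
theorem const (r : ℂ) : Φ.Linked (Matrix.of fun _ _ => r) (Matrix.of fun _ _ => r) := by
  refine ⟨r • C.J, ?_, ?_⟩
  · ext x y
    exact mul_one r
  · rw [_root_.map_smul, Φ.map_J]
    ext x y
    exact mul_one r

theorem left_eq_zero (h : Φ.Linked M 0) : M = 0 := by
  obtain ⟨m, rfl, hm⟩ := h
  have h0 : Φ.toEquiv m = 0 := Subtype.ext hm
  rw [LinearEquiv.map_eq_zero_iff] at h0
  rw [h0]; rfl

theorem right_eq_zero (h : Φ.Linked 0 N) : N = 0 := by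
  obtain ⟨m, hm, rfl⟩ := h
  have h0 : m = 0 := Subtype.ext hm
  rw [h0, _root_.map_zero]; rfl

theorem prod_sub (h : Φ.Linked M N) (F : Finset ℂ) :
    Φ.Linked (Matrix.of fun x y => ∏ β ∈ F, (M x y - β))
      (Matrix.of fun x y => ∏ β ∈ F, (N x y - β)) := by
  classical
  induction F using Finset.induction_on with
  | empty => simpa using const Φ 1
  | insert β F hβ ih =>
    simp only [Finset.prod_insert hβ]
    have h1 := (h.add (const Φ (-β))).schur ih
    convert h1 using 1 <;> (ext x y; simp [sub_eq_add_neg])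

/-- The indicator matrices of a value of two corresponding matrices correspond to each other. -/
theorem indicator (h : Φ.Linked M N) (α : ℂ) :
    Φ.Linked (Matrix.of fun x y => if M x y = α then 1 else 0)
      (Matrix.of fun x y => if N x y = α then 1 else 0) := by
  classical
  -- Lagrange interpolation in the Schur product: `F` holds all values of both matrices other than
  -- `α`, so one polynomial yields the indicator on both sides.
  let F : Finset ℂ := ((Finset.univ.image fun p : V × V => M p.1 p.2) ∪
    Finset.univ.image fun p : W × W => N p.1 p.2).erase α
  have hα : ∏ β ∈ F, (α - β) ≠ 0 := Finset.prod_ne_zero_iff.2 fun β hβ =>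
    sub_ne_zero.2 (Finset.ne_of_mem_erase hβ).symm
  have h1 := (h.prod_sub F).smul (∏ β ∈ F, (α - β))⁻¹
  have key : ∀ γ : ℂ, (γ ≠ α → γ ∈ F) →
      (if γ = α then (1 : ℂ) else 0) = (∏ β ∈ F, (α - β))⁻¹ • ∏ β ∈ F, (γ - β) := by
    intro γ hγ
    split_ifs with hc
    · rw [hc, smul_eq_mul, inv_mul_cancel₀ hα]
    · rw [Finset.prod_eq_zero (hγ hc) (sub_self γ), smul_zero]
  convert h1 using 1
  · ext x y
    refine key _ fun hne => Finset.mem_erase.2 ⟨hne, Finset.mem_union_left _ ?_⟩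
    exact Finset.mem_image.2 ⟨(x, y), Finset.mem_univ _, rfl⟩
  · ext x y
    refine key _ fun hne => Finset.mem_erase.2 ⟨hne, Finset.mem_union_right _ ?_⟩
    exact Finset.mem_image.2 ⟨(x, y), Finset.mem_univ _, rfl⟩

end CoherentAlgebra.Iso.Linked

theorem allOnes_mul_self : allOnes V * allOnes V = (Fintype.card V : ℂ) • allOnes V := by
  ext x y
  simp [allOnes, Matrix.mul_apply]

theorem allOnes_eq_zero_iff : allOnes V = 0 ↔ IsEmpty V := by
  constructor
  · intro h
    by_contra hV
    rw [not_isEmpty_iff] at hV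
    obtain ⟨x⟩ := hV
    exact one_ne_zero (congrFun (congrFun h x) x)
  · intro h
    ext x
    exact h.elim x

/-- The relation `J * J = |V| • J` is transported to the other side, where also `J * J = |W| • J`.
The sizes agree unless `J = 0` there; then `J = 0` on both sides and both sets are empty. -/
theorem GraphEquivalent.card_eq {X : SimpleGraph V} {Y : SimpleGraph W}
    (h : GraphEquivalent X Y) : Fintype.card V = Fintype.card W := by
  obtain ⟨Φ, -⟩ := h
  have hJ : Φ.Linked (allOnes V) (allOnes W) := Iso.Linked.const Φ 1
  have h1 := (hJ.mul hJ).add (hJ.smul (-(Fintype.card V : ℂ)))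
  rw [allOnes_mul_self, allOnes_mul_self, ← add_smul, ← add_smul, add_neg_cancel, zero_smul] at h1
  have h2 := h1.right_eq_zero
  rw [smul_eq_zero] at h2
  rcases h2 with h2 | h2
  · rw [add_neg_eq_zero] at h2
    exact_mod_cast h2.symm
  · have h3 := hJ
    rw [h2] at h3
    have h4 := allOnes_eq_zero_iff.1 h3.left_eq_zero
    have h5 := allOnes_eq_zero_iff.1 h2
    rw [Fintype.card_eq_zero, Fintype.card_eq_zero]

end Linked

/-! ### Weisfeiler-Leman refinement with numerical colours -/

section Coloring

/-- The number of `z < j` such that the cells `row + z` and `col + z * n` have colours `α`, `β`. -/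
def countPairs (n : ℕ) (c : ℕ → ℕ) (row col α β j : ℕ) : ℕ :=
  ((Finset.range j).filter fun z => c (row + z) = α ∧ c (col + z * n) = β).card

/-- Append the digits `f 0, …, f (j - 1)` to `d` in base `k`. -/
def appendDigits (k : ℕ) (f : ℕ → ℕ) (d : ℕ) : ℕ → ℕ
  | 0 => d
  | j + 1 => k * appendDigits k f d j + f j

/-- The number of ordered pairs of vertices of two graphs on `n` vertices. -/
def numCells (n : ℕ) : ℕ := n * n + n * n

/-- Append to the colour `d` the numbers of pairs of colours `c a`, `c b` with `a < j`. -/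
def appendCounts (n : ℕ) (c : ℕ → ℕ) (row col d : ℕ) : ℕ → ℕ
  | 0 => d
  | a + 1 => appendDigits (n + 1) (fun b => countPairs n c row col (c a) (c b) n)
      (appendCounts n c row col d a) (numCells n)

/-- One round of the Weisfeiler-Leman colour refinement. -/
def refine (n : ℕ) (c : ℕ → ℕ) (k : ℕ) : ℕ :=
  -- The two addresses are the first cell of the row and the first cell of the column of `k`, within
  -- the same graph.
  appendCounts n c (k / n * n) (k / (n * n) * (n * n) + k % n) (c k) (numCells n)

/-- The cell that represents the pair `(u, v)` of vertices of the graph number `s`. -/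
def cell (n : ℕ) (s : Fin 2) (u v : Fin n) : ℕ := s * (n * n) + u * n + v

variable {n : ℕ}

theorem cell_lt (s : Fin 2) (u v : Fin n) : cell n s u v < numCells n := by
  have hs : (s : ℕ) * (n * n) ≤ 1 * (n * n) := Nat.mul_le_mul_right _ (by omega)
  have hu : ((u : ℕ) + 1) * n ≤ n * n := Nat.mul_le_mul_right _ u.2
  have := v.2
  unfold cell numCells
  linarith

theorem refine_cell_of_lt (c : ℕ → ℕ) {s u v : ℕ} (hu : u < n) (hv : v < n) :
    refine n c (s * (n * n) + u * n + v) =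
      appendCounts n c (s * (n * n) + u * n) (s * (n * n) + v)
        (c (s * (n * n) + u * n + v)) (numCells n) := by
  have hn : 0 < n := by omega
  have h1 : (s * (n * n) + u * n + v) / n = s * n + u := by
    rw [show s * (n * n) + u * n + v = v + n * (s * n + u) by ring,
      Nat.add_mul_div_left _ _ hn, Nat.div_eq_of_lt hv, zero_add]
  have h2 : (s * (n * n) + u * n + v) % n = v := by
    rw [show s * (n * n) + u * n + v = v + n * (s * n + u) by ring,
      Nat.add_mul_mod_self_left, Nat.mod_eq_of_lt hv]
  have h3 : (s * (n * n) + u * n + v) / (n * n) = s := by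
    rw [← Nat.div_div_eq_div_mul, h1, mul_comm s n, add_comm, Nat.add_mul_div_left _ _ hn,
      Nat.div_eq_of_lt hu, zero_add]
  unfold refine
  rw [h1, h2, h3]
  congr 1
  ring

theorem refine_cell (c : ℕ → ℕ) (s : Fin 2) (u v : Fin n) :
    refine n c (cell n s u v) =
      appendCounts n c (s * (n * n) + u * n) (s * (n * n) + v) (c (cell n s u v)) (numCells n) :=
  refine_cell_of_lt c u.2 v.2

theorem exists_cell {k : ℕ} (hk : k < numCells n) : ∃ s u v, cell n s u v = k := by
  have hn : 0 < n := by
    rcases Nat.eq_zero_or_pos n with rfl | h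
    · simp [numCells] at hk
    · exact h
  refine ⟨⟨k / n / n, ?_⟩, ⟨k / n % n, Nat.mod_lt _ hn⟩, ⟨k % n, Nat.mod_lt _ hn⟩, ?_⟩
  · rw [Nat.div_div_eq_div_mul, Nat.div_lt_iff_lt_mul (by positivity)]
    unfold numCells at hk
    linarith
  · have h1 := Nat.div_add_mod k n
    have h2 := Nat.div_add_mod (k / n) n
    unfold cell
    dsimp only
    calc k / n / n * (n * n) + k / n % n * n + k % n
        = n * (n * (k / n / n) + k / n % n) + k % n := by ring
      _ = k := by rw [h2, h1]

theorem countPairs_cell (c : ℕ → ℕ) (s : Fin 2) (u v : Fin n) (α β : ℕ) :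
    countPairs n c (s * (n * n) + u * n) (s * (n * n) + v) α β n =
      (Finset.univ.filter fun z : Fin n => c (cell n s u z) = α ∧ c (cell n s z v) = β).card := by
  unfold countPairs
  rw [Finset.card_filter, Finset.card_filter, Finset.sum_range]
  refine Finset.sum_congr rfl fun z _ => ?_
  rw [cell, cell, add_right_comm _ (v : ℕ)]

theorem countPairs_lt (c : ℕ → ℕ) (row col α β : ℕ) : countPairs n c row col α β n < n + 1 :=
  Nat.lt_succ_of_le ((Finset.card_filter_le _ _).trans (Finset.card_range n).le)

/-- Division by `k` with remainder removes the last digit. Counts are at most `n`, which is why the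
base is `n + 1`. -/
theorem appendDigits_inj {k : ℕ} {f g : ℕ → ℕ} (hf : ∀ j, f j < k) (hg : ∀ j, g j < k)
    {d e J : ℕ} (h : appendDigits k f d J = appendDigits k g e J) :
    d = e ∧ ∀ j < J, f j = g j := by
  induction J with
  | zero => exact ⟨h, fun j hj => absurd hj (Nat.not_lt_zero j)⟩
  | succ J ih =>
    simp only [appendDigits] at h
    have hk : 0 < k := (Nat.zero_le _).trans_lt (hf 0)
    have h1 := congrArg (· / k) h
    have h2 := congrArg (· % k) h
    simp only [Nat.mul_add_div hk, Nat.div_eq_of_lt (hf J), Nat.div_eq_of_lt (hg J),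
      add_zero] at h1
    simp only [Nat.mul_add_mod, Nat.mod_eq_of_lt (hf J), Nat.mod_eq_of_lt (hg J)] at h2
    obtain ⟨h3, h4⟩ := ih h1
    refine ⟨h3, fun j hj => ?_⟩
    rcases Nat.lt_succ_iff_lt_or_eq.1 hj with hj | rfl
    · exact h4 j hj
    · exact h2

theorem appendCounts_inj {c : ℕ → ℕ} {row col row' col' d e J : ℕ}
    (h : appendCounts n c row col d J = appendCounts n c row' col' e J) :
    d = e ∧ ∀ a < J, ∀ b < numCells n,
      countPairs n c row col (c a) (c b) n = countPairs n c row' col' (c a) (c b) n := by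
  induction J with
  | zero => exact ⟨h, fun j hj => absurd hj (Nat.not_lt_zero j)⟩
  | succ J ih =>
    obtain ⟨h1, h2⟩ := appendDigits_inj (fun _ => countPairs_lt _ _ _ _ _)
      (fun _ => countPairs_lt _ _ _ _ _) h
    obtain ⟨h3, h4⟩ := ih h1
    refine ⟨h3, fun a ha => ?_⟩
    rcases Nat.lt_succ_iff_lt_or_eq.1 ha with ha | rfl
    · exact h4 a ha
    · exact h2

theorem refine_inj {c : ℕ → ℕ} {s t : Fin 2} {u v u' v' : Fin n}
    (h : refine n c (cell n s u v) = refine n c (cell n t u' v')) :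
    c (cell n s u v) = c (cell n t u' v') ∧ ∀ α β,
      (Finset.univ.filter fun z : Fin n => c (cell n s u z) = α ∧ c (cell n s z v) = β).card =
      (Finset.univ.filter fun z : Fin n =>
        c (cell n t u' z) = α ∧ c (cell n t z v') = β).card := by
  rw [refine_cell, refine_cell] at h
  obtain ⟨h1, h2⟩ := appendCounts_inj h
  refine ⟨h1, fun α β => ?_⟩
  -- The digits are indexed by cells and so record only colours that occur; for any other colour
  -- both counts are `0`.
  by_cases hα : ∃ a < numCells n, c a = α
  · by_cases hβ : ∃ b < numCells n, c b = β
    · obtain ⟨a, ha, rfl⟩ := hα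
      obtain ⟨b, hb, rfl⟩ := hβ
      rw [← countPairs_cell, ← countPairs_cell]
      exact h2 a ha b hb
    · rw [Finset.filter_false_of_mem, Finset.filter_false_of_mem]
      · exact fun z _ hz => hβ ⟨_, cell_lt t z v', hz.2⟩
      · exact fun z _ hz => hβ ⟨_, cell_lt s z v, hz.2⟩
  · rw [Finset.filter_false_of_mem, Finset.filter_false_of_mem]
    · exact fun z _ hz => hα ⟨_, cell_lt t u' z, hz.1⟩
    · exact fun z _ hz => hα ⟨_, cell_lt s u z, hz.1⟩

/-- Refinement depends only on the colours of the cells. -/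
theorem refine_congr {c c' : ℕ → ℕ} (h : ∀ k < numCells n, c k = c' k) {k : ℕ}
    (hk : k < numCells n) : refine n c k = refine n c' k := by
  obtain ⟨s, u, v, rfl⟩ := exists_cell hk
  rw [refine_cell, refine_cell, h _ hk]
  have hcount : ∀ α β, countPairs n c (s * (n * n) + u * n) (s * (n * n) + v) α β n =
      countPairs n c' (s * (n * n) + u * n) (s * (n * n) + v) α β n := by
    intro α β
    rw [countPairs_cell, countPairs_cell]
    simp only [h _ (cell_lt _ _ _)]
  have hdig : ∀ a < numCells n, ∀ d, ∀ J ≤ numCells n,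
      appendDigits (n + 1) (fun b => countPairs n c (s * (n * n) + u * n) (s * (n * n) + v)
        (c a) (c b) n) d J =
      appendDigits (n + 1) (fun b => countPairs n c' (s * (n * n) + u * n) (s * (n * n) + v)
        (c' a) (c' b) n) d J := by
    intro a ha d J hJ
    induction J with
    | zero => rfl
    | succ J ih => simp only [appendDigits]; rw [ih (by omega), hcount, h a ha, h J (by omega)]
  have : ∀ d, ∀ J ≤ numCells n,
      appendCounts n c (s * (n * n) + u * n) (s * (n * n) + v) d J =
      appendCounts n c' (s * (n * n) + u * n) (s * (n * n) + v) d J := by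
    intro d J hJ
    induction J with
    | zero => rfl
    | succ J ih => simp only [appendCounts]; rw [ih (by omega), hdig _ (by omega) _ _ le_rfl]
  exact this _ _ le_rfl

end Coloring

/-! ### Refinement is preserved by isomorphisms -/

section Linked

open CoherentAlgebra

variable {n : ℕ} {C D : CoherentAlgebra (Fin n)}

/-- The colours of the pairs of vertices of the graph number `s`, as a matrix. -/
def colorMatrix (n : ℕ) (c : ℕ → ℕ) (s : Fin 2) : Matrix (Fin n) (Fin n) ℂ :=
  Matrix.of fun u v => (c (cell n s u v) : ℂ)

theorem linked_appendDigits {Φ : C.Iso D} {k : ℕ} {f : Fin 2 → Fin n → Fin n → ℕ → ℕ}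
    {d : Fin 2 → Fin n → Fin n → ℕ}
    (hf : ∀ j, Φ.Linked (Matrix.of fun u v => (f 0 u v j : ℂ)) (Matrix.of fun u v => (f 1 u v j : ℂ)))
    (hd : Φ.Linked (Matrix.of fun u v => (d 0 u v : ℂ)) (Matrix.of fun u v => (d 1 u v : ℂ)))
    (J : ℕ) :
    Φ.Linked (Matrix.of fun u v => (appendDigits k (f 0 u v) (d 0 u v) J : ℂ))
      (Matrix.of fun u v => (appendDigits k (f 1 u v) (d 1 u v) J : ℂ)) := by
  induction J with
  | zero => exact hd
  | succ J ih =>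
    convert (ih.smul (k : ℂ)).add (hf J) using 1 <;>
      (ext u v; simp [appendDigits])

/-- The matrix of counts is the product of the indicator matrices of `α` and `β`. -/
theorem linked_countPairs {Φ : C.Iso D} {c : ℕ → ℕ}
    (h : Φ.Linked (colorMatrix n c 0) (colorMatrix n c 1)) (α β : ℕ) :
    Φ.Linked
      (Matrix.of fun u v => (countPairs n c ((0 : Fin 2) * (n * n) + u * n)
        ((0 : Fin 2) * (n * n) + v) α β n : ℂ))
      (Matrix.of fun u v => (countPairs n c ((1 : Fin 2) * (n * n) + u * n)
        ((1 : Fin 2) * (n * n) + v) α β n : ℂ)) := by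
  convert (h.indicator α).mul (h.indicator β) using 1 <;>
  · ext u v
    rw [Matrix.of_apply, countPairs_cell]
    simp only [Matrix.mul_apply, colorMatrix, Finset.card_filter, Matrix.of_apply, Nat.cast_inj]
    push_cast
    exact Finset.sum_congr rfl fun z _ => by split_ifs <;> simp_all

theorem linked_refine {Φ : C.Iso D} {c : ℕ → ℕ}
    (h : Φ.Linked (colorMatrix n c 0) (colorMatrix n c 1)) :
    Φ.Linked (colorMatrix n (refine n c) 0) (colorMatrix n (refine n c) 1) := by
  have key : ∀ J, Φ.Linked
      (Matrix.of fun u v => (appendCounts n c ((0 : Fin 2) * (n * n) + u * n)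
        ((0 : Fin 2) * (n * n) + v) (c (cell n 0 u v)) J : ℂ))
      (Matrix.of fun u v => (appendCounts n c ((1 : Fin 2) * (n * n) + u * n)
        ((1 : Fin 2) * (n * n) + v) (c (cell n 1 u v)) J : ℂ)) := by
    intro J
    induction J with
    | zero => exact h
    | succ J ih =>
      exact linked_appendDigits
        (f := fun s u v b => countPairs n c (s * (n * n) + u * n) (s * (n * n) + v) (c J) (c b) n)
        (d := fun s u v => appendCounts n c (s * (n * n) + u * n) (s * (n * n) + v)
          (c (cell n s u v)) J)
        (fun j => linked_countPairs h _ _) ih (numCells n)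
  simpa only [colorMatrix, refine_cell] using key (numCells n)

/-- The initial colours: `2` on the diagonal, and the entries of the adjacency matrices. -/
def IsInitialColoring (X Y : SimpleGraph (Fin n)) (c : ℕ → ℕ) : Prop :=
  ∀ (s : Fin 2) (u v : Fin n), open Classical in
    c (cell n s u v) = if u = v then 2 else if (![X, Y] s).Adj u v then 1 else 0

theorem colorMatrix_initial {X Y : SimpleGraph (Fin n)} {c : ℕ → ℕ}
    (hc : IsInitialColoring X Y c) (s : Fin 2) :
    colorMatrix n c s = adj (![X, Y] s) + (2 : ℂ) • 1 := by
  ext u v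
  rw [colorMatrix, Matrix.of_apply, hc]
  by_cases huv : u = v
  · subst huv
    simp [adj]
  · by_cases ha : (![X, Y] s).Adj u v <;> simp [adj, huv, ha]

/-- If the colour were missing in the first graph, its indicator there would be zero, and the
isomorphism would send zero to the nonzero indicator in the second graph. -/
theorem GraphEquivalent.exists_color_eq {X Y : SimpleGraph (Fin n)} (h : GraphEquivalent X Y)
    {c : ℕ → ℕ} (hc : IsInitialColoring X Y c) (k : ℕ) (u' v' : Fin n) :
    ∃ u v, (refine n)^[k] c (cell n 0 u v) = (refine n)^[k] c (cell n 1 u' v') := by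
  obtain ⟨Φ, hΦ⟩ := h
  have hlink : ∀ k, Φ.Linked (colorMatrix n ((refine n)^[k] c) 0)
      (colorMatrix n ((refine n)^[k] c) 1) := by
    intro k
    induction k with
    | zero =>
      have h1 : Φ.Linked (adj X) (adj Y) := ⟨adjElem X, rfl, by rw [hΦ]; rfl⟩
      have h2 := h1.add ((Iso.Linked.one Φ).smul 2)
      rw [Function.iterate_zero, id, colorMatrix_initial hc, colorMatrix_initial hc]
      exact h2
    | succ k ih =>
      rw [Function.iterate_succ_apply']
      exact linked_refine ih
  by_contra! hne
  have h1 := (hlink k).indicator ((refine n)^[k] c (cell n 1 u' v') : ℂ)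
  have h2 : (Matrix.of fun x y => if colorMatrix n ((refine n)^[k] c) 0 x y =
      ((refine n)^[k] c (cell n 1 u' v') : ℂ) then (1 : ℂ) else 0) = 0 := by
    ext u v
    simp only [Matrix.of_apply, colorMatrix, Nat.cast_inj, hne u v, if_false, Matrix.zero_apply]
  rw [h2] at h1
  have h3 := congrFun (congrFun h1.right_eq_zero u') v'
  simp [colorMatrix] at h3

end Linked

/-! ### Stable colourings give equivalences -/

section Stable

variable {n : ℕ}

/-- The component number `s` of a pair of matrices. -/
def sideMatrix (p : Matrix (Fin n) (Fin n) ℂ × Matrix (Fin n) (Fin n) ℂ) (s : Fin 2) :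
    Matrix (Fin n) (Fin n) ℂ := ![p.1, p.2] s

/-- The pairs of vertices of two graphs, coloured in such a way that the colour classes are
relations of a coherent configuration. -/
structure IsStableColoring (X Y : SimpleGraph (Fin n)) (c : Fin 2 × Fin n × Fin n → ℕ) : Prop where
  diag : ∀ {s t u v u' v'}, c (s, u, v) = c (t, u', v') → (u = v ↔ u' = v')
  adj : ∀ {s t u v u' v'}, c (s, u, v) = c (t, u', v') →
    ((![X, Y] s).Adj u v ↔ (![X, Y] t).Adj u' v')
  symm : ∀ {s t u v u' v'}, c (s, u, v) = c (t, u', v') → c (s, v, u) = c (t, v', u')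
  count : ∀ {s t u v u' v'}, c (s, u, v) = c (t, u', v') → ∀ α β,
    (Finset.univ.filter fun z => c (s, u, z) = α ∧ c (s, z, v) = β).card =
      (Finset.univ.filter fun z => c (t, u', z) = α ∧ c (t, z, v') = β).card

namespace IsStableColoring

variable {X Y : SimpleGraph (Fin n)} {c : Fin 2 × Fin n × Fin n → ℕ}

/-- One shared colour spreads to all: the counts allow moving from `(u, v)` to `(u, x)`,
transposition gives `(x, u)`, and the counts again give `(x, y)`. -/
theorem exists_color_eq (hc : IsStableColoring X Y c) {s t : Fin 2} {u v u' v' : Fin n}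
    (h : c (s, u, v) = c (t, u', v')) (x y : Fin n) : ∃ x' y', c (s, x, y) = c (t, x', y') := by
  have row : ∀ {u v u' v' : Fin n}, c (s, u, v) = c (t, u', v') →
      ∀ z, ∃ z', c (s, u, z) = c (t, u', z') := by
    intro u v u' v' h z
    have h1 := hc.count h (c (s, u, z)) (c (s, z, v))
    have h2 : 0 < (Finset.univ.filter fun z' =>
        c (t, u', z') = c (s, u, z) ∧ c (t, z', v') = c (s, z, v)).card := by
      rw [← h1]
      exact Finset.card_pos.2 ⟨z, by simp⟩
    obtain ⟨z', hz'⟩ := Finset.card_pos.1 h2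
    exact ⟨z', (Finset.mem_filter.1 hz').2.1.symm⟩
  obtain ⟨x', hx'⟩ := row h x
  obtain ⟨y', hy'⟩ := row (hc.symm hx') y
  exact ⟨x', y', hy'⟩

/-- The counts say that the multisets of colour pairs along the paths of length two agree. This
gives closure of `pairs` under matrix products. -/
theorem sum_eq (hc : IsStableColoring X Y c) {s t : Fin 2} {u v u' v' : Fin n}
    (h : c (s, u, v) = c (t, u', v')) (g : ℕ × ℕ → ℂ) :
    ∑ z, g (c (s, u, z), c (s, z, v)) = ∑ z, g (c (t, u', z), c (t, z, v')) := by
  have hm : (Finset.univ.val.map fun z => (c (s, u, z), c (s, z, v))) =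
      Finset.univ.val.map fun z => (c (t, u', z), c (t, z, v')) := by
    ext ⟨α, β⟩
    rw [Multiset.count_map, Multiset.count_map]
    simpa only [Prod.mk.injEq, eq_comm, Finset.card_def, Finset.filter_val] using hc.count h α β
  have := congrArg (fun m => (m.map g).sum) hm
  rw [Multiset.map_map, Multiset.map_map] at this
  exact this

/-- The pairs of matrices whose entries depend only on the colours. -/
def pairs (hc : IsStableColoring X Y c) :
    StarSubalgebra ℂ (Matrix (Fin n) (Fin n) ℂ × Matrix (Fin n) (Fin n) ℂ) where
  carrier := {p | Function.FactorsThrough (fun i => sideMatrix p i.1 i.2.1 i.2.2) c}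
  mul_mem' := by
    rintro p q hp hq ⟨s, u, v⟩ ⟨t, u', v'⟩ h
    have hmul : ∀ s, sideMatrix (p * q) s = sideMatrix p s * sideMatrix q s := by
      intro s; fin_cases s <;> rfl
    -- `Function.extend` turns entries into functions of the colour; its default value `0` is never
    -- evaluated in these sums.
    have h1 := hc.sum_eq h fun x =>
      Function.extend c (fun i => sideMatrix p i.1 i.2.1 i.2.2) 0 x.1 *
        Function.extend c (fun i => sideMatrix q i.1 i.2.1 i.2.2) 0 x.2
    simp only [hp.extend_apply, hq.extend_apply] at h1
    simpa only [hmul, Matrix.mul_apply] using h1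
  add_mem' := by
    rintro p q hp hq ⟨s, u, v⟩ ⟨t, u', v'⟩ h
    have hadd : ∀ s, sideMatrix (p + q) s = sideMatrix p s + sideMatrix q s := by
      intro s; fin_cases s <;> rfl
    have h1 := hp h
    have h2 := hq h
    dsimp only at h1 h2 ⊢
    rw [hadd, hadd, Matrix.add_apply, Matrix.add_apply, h1, h2]
  algebraMap_mem' := by
    rintro r ⟨s, u, v⟩ ⟨t, u', v'⟩ h
    have halg : ∀ s, sideMatrix (algebraMap ℂ (Matrix (Fin n) (Fin n) ℂ ×
        Matrix (Fin n) (Fin n) ℂ) r) s = algebraMap ℂ (Matrix (Fin n) (Fin n) ℂ) r := by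
      intro s; fin_cases s <;> rfl
    dsimp only
    rw [halg, halg, Matrix.algebraMap_matrix_apply, Matrix.algebraMap_matrix_apply]
    simp only [hc.diag h]
  star_mem' := by
    rintro p hp ⟨s, u, v⟩ ⟨t, u', v'⟩ h
    have hstar : ∀ s, sideMatrix (star p) s = star (sideMatrix p s) := by
      intro s; fin_cases s <;> rfl
    have h1 := hp (hc.symm h)
    dsimp only at h1 ⊢
    rw [hstar, hstar, Matrix.star_apply, Matrix.star_apply, h1]

theorem graphEquivalent (hc : IsStableColoring X Y c) {u v u' v' : Fin n}
    (h : c (0, u, v) = c (1, u', v')) : GraphEquivalent X Y := by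
  have hmem : ∀ p, p ∈ hc.pairs ↔
    Function.FactorsThrough (fun i => sideMatrix p i.1 i.2.1 i.2.2) c := fun p => Iff.rfl
  refine graphEquivalent_of_starSubalgebra hc.pairs ?_ ?_ ?_ ?_ ?_
  · rw [hmem]
    rintro ⟨s, u, v⟩ ⟨t, u', v'⟩ -
    fin_cases s <;> fin_cases t <;> rfl
  · intro p hp q hq
    rw [hmem] at *
    rintro ⟨s, u, v⟩ ⟨t, u', v'⟩ h
    have hs : ∀ s, sideMatrix (p.1 ⊙ q.1, p.2 ⊙ q.2) s = sideMatrix p s ⊙ sideMatrix q s := by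
      intro s; fin_cases s <;> rfl
    have h1 := hp h
    have h2 := hq h
    dsimp only at h1 h2 ⊢
    rw [hs, hs, Matrix.hadamard_apply, Matrix.hadamard_apply, h1, h2]
  · rw [hmem]
    rintro ⟨s, u, v⟩ ⟨t, u', v'⟩ h
    have hs : ∀ s, sideMatrix (QIso.adj X, QIso.adj Y) s = QIso.adj (![X, Y] s) := by
      intro s; fin_cases s <;> rfl
    dsimp only
    rw [hs, hs]
    simp only [QIso.adj, SimpleGraph.adjMatrix_apply]
    classical exact if_congr (hc.adj h) rfl rfl
  · intro p hp h0
    ext x y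
    obtain ⟨x', y', hxy⟩ := hc.exists_color_eq h.symm x y
    have h1 : p.2 x y = p.1 x' y' := hp hxy
    rw [h1, h0]; rfl
  · intro p hp h0
    ext x y
    obtain ⟨x', y', hxy⟩ := hc.exists_color_eq h x y
    have h1 : p.1 x y = p.2 x' y' := hp hxy
    rw [h1, h0]; rfl

end IsStableColoring

/-- On `A` the map `f` factors through `g`, so `A.image g` maps onto `A.image f`; if it has no more
elements, that surjection is injective. -/
theorem card_image_le_of_refines {α : Type*} {A : Finset α} {f g : α → ℕ}
    (h : ∀ x ∈ A, ∀ y ∈ A, g x = g y → f x = f y) :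
    (A.image f).card ≤ (A.image g).card ∧
      ((A.image g).card ≤ (A.image f).card → ∀ x ∈ A, ∀ y ∈ A, f x = f y → g x = g y) := by
  classical
  rcases A.eq_empty_or_nonempty with rfl | ⟨x₀, -⟩
  · simp
  have : Nonempty α := ⟨x₀⟩
  choose! φ hφ using fun (a : ℕ) (ha : a ∈ A.image g) => Finset.mem_image.1 ha
  have hφf : ∀ x ∈ A, f (φ (g x)) = f x := fun x hx =>
    h _ (hφ _ (Finset.mem_image_of_mem g hx)).1 _ hx (hφ _ (Finset.mem_image_of_mem g hx)).2
  have himg : (A.image g).image (f ∘ φ) = A.image f := by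
    rw [Finset.image_image]
    exact Finset.image_congr fun x hx => hφf x hx
  refine ⟨himg ▸ Finset.card_image_le, fun hcard x hx y hy hxy => ?_⟩
  have hinj := Finset.card_image_iff.1 (le_antisymm Finset.card_image_le (by rwa [himg]))
  refine hinj (Finset.mem_image_of_mem g hx) (Finset.mem_image_of_mem g hy) ?_
  simpa only [Function.comp_apply, hφf x hx, hφf y hy] using hxy

theorem refine_refines {c : ℕ → ℕ} {p q : ℕ} (hp : p < numCells n) (hq : q < numCells n)
    (h : refine n c p = refine n c q) : c p = c q := by
  obtain ⟨s, u, v, rfl⟩ := exists_cell hp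
  obtain ⟨t, u', v', rfl⟩ := exists_cell hq
  exact (refine_inj h).1

theorem iterate_refine_refines {c : ℕ → ℕ} {p q : ℕ} (hp : p < numCells n) (hq : q < numCells n)
    {j k : ℕ} (hjk : j ≤ k) (h : (refine n)^[k] c p = (refine n)^[k] c q) :
    (refine n)^[j] c p = (refine n)^[j] c q := by
  induction hjk with
  | refl => exact h
  | step _ ih =>
    rw [Function.iterate_succ_apply'] at h
    exact ih (refine_refines hp hq h)

/-- The refinement is stable after some round before the one whose number is that of the cells. -/
theorem exists_stable (hn : 0 < n) (c : ℕ → ℕ) :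
    ∃ k ≤ numCells n, ∀ p < numCells n, ∀ q < numCells n,
      (refine n)^[k] c p = (refine n)^[k] c q →
        (refine n)^[k + 1] c p = (refine n)^[k + 1] c q := by
  by_contra! hne
  have hL : 0 < numCells n := Nat.add_pos_left (Nat.mul_pos hn hn) _
  -- Every unstable round creates at least one new colour, so `L` of them after the start would give
  -- `L + 1` colours on `L` cells.
  have hcard : ∀ k ≤ numCells n,
      k + 1 ≤ ((Finset.range (numCells n)).image ((refine n)^[k] c)).card := by
    intro k hk
    induction k with
    | zero =>
      exact Finset.card_pos.2 ((Finset.nonempty_range_iff.2 hL.ne').image _)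
    | succ k ih =>
      have h1 := card_image_le_of_refines (A := Finset.range (numCells n))
        (f := (refine n)^[k] c) (g := (refine n)^[k + 1] c) fun x hx y hy h =>
          iterate_refine_refines (Finset.mem_range.1 hx) (Finset.mem_range.1 hy) k.le_succ h
      have h2 := ih (by omega)
      by_contra! hlt
      obtain ⟨p, hp, q, hq, h3, h4⟩ := hne k (by omega)
      exact h4 (h1.2 (by omega) p (Finset.mem_range.2 hp) q (Finset.mem_range.2 hq) h3)
  have h1 := hcard _ le_rfl
  have h2 := Finset.card_image_le (s := Finset.range (numCells n))
    (f := (refine n)^[numCells n] c)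
  rw [Finset.card_range] at h2
  omega

/-- By induction transposition acts on colours, so a path `(v, z), (z, u)` with colours `α, β` is a
path `(u, z), (z, v)` with the transposed colours in the opposite order, and the counts for `(u, v)`
determine those for `(v, u)`. -/
theorem IsInitialColoring.iterate_symm {X Y : SimpleGraph (Fin n)} {c : ℕ → ℕ}
    (hc : IsInitialColoring X Y c) (k : ℕ) {s t : Fin 2} {u v u' v' : Fin n}
    (h : (refine n)^[k] c (cell n s u v) = (refine n)^[k] c (cell n t u' v')) :
    (refine n)^[k] c (cell n s v u) = (refine n)^[k] c (cell n t v' u') := by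
  induction k generalizing s t u v u' v' with
  | zero =>
    have h1 : ∀ (s : Fin 2) (u v : Fin n), c (cell n s v u) = c (cell n s u v) := by
      intro s u v
      rw [hc, hc]
      classical exact if_congr eq_comm rfl (if_congr (SimpleGraph.adj_comm _ _ _) rfl rfl)
    simpa only [Function.iterate_zero, id, h1] using h
  | succ k ih =>
    simp only [Function.iterate_succ_apply'] at h ⊢
    set d := (refine n)^[k] c
    obtain ⟨h1, h2⟩ := refine_inj h
    have hcount : ∀ a < numCells n, ∀ b < numCells n,
        countPairs n d (s * (n * n) + v * n) (s * (n * n) + u) (d a) (d b) n =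
        countPairs n d (t * (n * n) + v' * n) (t * (n * n) + u') (d a) (d b) n := by
      intro a ha b hb
      obtain ⟨sa, xa, ya, rfl⟩ := exists_cell ha
      obtain ⟨sb, xb, yb, rfl⟩ := exists_cell hb
      have hsw : ∀ {s s' : Fin 2} {x y x' y' : Fin n},
          d (cell n s x y) = d (cell n s' x' y') ↔ d (cell n s y x) = d (cell n s' y' x') :=
        ⟨fun h => ih h, fun h => ih h⟩
      have h3 := h2 (d (cell n sb yb xb)) (d (cell n sa ya xa))
      rw [countPairs_cell, countPairs_cell]
      simp only [hsw (x' := xa), hsw (x' := xb)]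
      simpa only [and_comm] using h3
    rw [refine_cell, refine_cell, ih h1]
    have hJ : ∀ e J, J ≤ numCells n →
        appendCounts n d (s * (n * n) + v * n) (s * (n * n) + u) e J =
        appendCounts n d (t * (n * n) + v' * n) (t * (n * n) + u') e J := by
      intro e J hJ
      induction J with
      | zero => rfl
      | succ J ihJ =>
        have hI : ∀ I ≤ numCells n, ∀ e,
            appendDigits (n + 1) (fun b => countPairs n d (s * (n * n) + v * n)
              (s * (n * n) + u) (d J) (d b) n) e I =
            appendDigits (n + 1) (fun b => countPairs n d (t * (n * n) + v' * n)
              (t * (n * n) + u') (d J) (d b) n) e I := by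
          intro I hI e
          induction I with
          | zero => rfl
          | succ I ihI =>
            simp only [appendDigits]
            rw [ihI (by omega), hcount J (by omega) I (by omega)]
        simp only [appendCounts]
        rw [ihJ (by omega), hI _ le_rfl]
    exact hJ _ _ le_rfl

/-- Equivalence of graphs is decided by Weisfeiler-Leman colour refinement. -/
theorem graphEquivalent_iff_exists_color_eq (hn : 0 < n) {X Y : SimpleGraph (Fin n)} {c : ℕ → ℕ}
    (hc : IsInitialColoring X Y c) :
    GraphEquivalent X Y ↔ ∃ p < n * n,
      (refine n)^[numCells n] c p = (refine n)^[numCells n] c (n * n) := by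
  have hcell : cell n 1 ⟨0, hn⟩ ⟨0, hn⟩ = n * n := by simp [cell]
  constructor
  · intro h
    obtain ⟨u, v, huv⟩ := h.exists_color_eq hc (numCells n) ⟨0, hn⟩ ⟨0, hn⟩
    rw [hcell] at huv
    refine ⟨_, ?_, huv⟩
    have hu : ((u : ℕ) + 1) * n ≤ n * n := Nat.mul_le_mul_right _ u.2
    have := v.2
    simp only [cell, Fin.coe_ofNat_eq_mod, Nat.zero_mod, zero_mul, zero_add]
    linarith
  · rintro ⟨p, hp, h⟩
    -- Stability is known only for some round `k` up to the last one; since rounds only refine, the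
    -- equality of colours in the last round descends to round `k`.
    obtain ⟨k, hk, hstable⟩ := exists_stable hn c
    rw [← hcell] at h
    have hpL : p < numCells n := hp.trans_le (Nat.le_add_right _ _)
    have h1 := iterate_refine_refines hpL (cell_lt _ _ _) hk h
    have h2 : p = cell n 0 ⟨p / n, (Nat.div_lt_iff_lt_mul hn).2 hp⟩ ⟨p % n, Nat.mod_lt _ hn⟩ := by
      simp only [cell, Fin.coe_ofNat_eq_mod, Nat.zero_mod, zero_mul, zero_add]
      exact (Nat.div_add_mod' p n).symm
    rw [h2] at h1
    have hinit : ∀ {s t : Fin 2} {u v u' v' : Fin n},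
        (refine n)^[k] c (cell n s u v) = (refine n)^[k] c (cell n t u' v') →
          (u = v ↔ u' = v') ∧ ((![X, Y] s).Adj u v ↔ (![X, Y] t).Adj u' v') := by
      intro s t u v u' v' h
      have h0 : c (cell n s u v) = c (cell n t u' v') :=
        iterate_refine_refines (cell_lt _ _ _) (cell_lt _ _ _) (Nat.zero_le k) h
      rw [hc, hc] at h0
      by_cases e : u = v
      · subst e
        by_cases e' : u' = v'
        · subst e'
          simp
        · exfalso
          by_cases a' : (![X, Y] t).Adj u' v' <;> simp [e', a'] at h0
      · by_cases e' : u' = v'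
        · exfalso
          by_cases a : (![X, Y] s).Adj u v <;> simp [e, e', a] at h0
        · by_cases a : (![X, Y] s).Adj u v <;> by_cases a' : (![X, Y] t).Adj u' v' <;>
            simp [e, e', a, a'] at h0 ⊢
    have hs : IsStableColoring X Y fun i => (refine n)^[k] c (cell n i.1 i.2.1 i.2.2) :=
      { diag := fun h => (hinit h).1
        adj := fun h => (hinit h).2
        symm := fun h => hc.iterate_symm k h
        count := fun h => by
          have h3 := hstable _ (cell_lt _ _ _) _ (cell_lt _ _ _) h
          rw [Function.iterate_succ_apply'] at h3
          exact (refine_inj h3).2 }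
    exact hs.graphEquivalent h1

end Stable

/-! ### Reasoning about programs with time bounds -/

section Machine

@[simp] theorem RamState.reg_setReg (s : RamState) (r v r' : ℕ) :
    (s.setReg r v).reg r' = if r' = r then v else s.reg r' := by
  simp [RamState.setReg, Function.update_apply]

@[simp] theorem RamState.mem_setReg (s : RamState) (r v : ℕ) : (s.setReg r v).mem = s.mem := rfl

@[simp] theorem RamState.reg_setMem (s : RamState) (a v : ℕ) : (s.setMem a v).reg = s.reg := rfl

@[simp] theorem RamState.mem_setMem (s : RamState) (a v k : ℕ) :
    (s.setMem a v).mem k = if k = a then v else s.mem k := by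
  simp [RamState.setMem, Function.update_apply]

/-- Started in `s`, the program `P` halts after at most `T` steps in a state that satisfies `Q`. -/
def Exec (P : RamProg) (s : RamState) (T : ℕ) (Q : RamState → Prop) : Prop :=
  ∃ t s', Runs P s t s' ∧ t ≤ T ∧ Q s'

namespace Exec

variable {P R : RamProg} {s : RamState} {T T₁ T₂ : ℕ} {Q Q₁ : RamState → Prop}

theorem mono (h : Exec P s T₁ Q₁) (hT : T₁ ≤ T) (hQ : ∀ s', Q₁ s' → Q s') : Exec P s T Q := by
  obtain ⟨t, s', h1, h2, h3⟩ := h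
  exact ⟨t, s', h1, h2.trans hT, hQ _ h3⟩

theorem seq (h₁ : Exec P s T₁ Q₁) (h₂ : ∀ s', Q₁ s' → Exec R s' T₂ Q) (hT : T₁ + T₂ ≤ T) :
    Exec (.seq P R) s T Q := by
  obtain ⟨t, s', h1, h2, h3⟩ := h₁
  obtain ⟨t', s'', h1', h2', h3'⟩ := h₂ s' h3
  exact ⟨_, s'', .seq h1 h1', by omega, h3'⟩

theorem const {r c : ℕ} (h : Q (s.setReg r c)) : Exec (.const r c) s (T + 1) Q :=
  ⟨1, _, .const r c s, by omega, h⟩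

theorem add {r a b : ℕ} (h : Q (s.setReg r (s.reg a + s.reg b))) :
    Exec (.add r a b) s (T + 1) Q :=
  ⟨1, _, .add r a b s, by omega, h⟩

theorem const_seq {r c : ℕ} (h : Exec P (s.setReg r c) T Q) :
    Exec (.seq (.const r c) P) s (T + 1) Q :=
  seq (T₁ := 1) ⟨1, _, .const r c s, le_rfl, rfl⟩ (by rintro _ rfl; exact h) (by omega)

theorem add_seq {r a b : ℕ} (h : Exec P (s.setReg r (s.reg a + s.reg b)) T Q) :
    Exec (.seq (.add r a b) P) s (T + 1) Q :=
  seq (T₁ := 1) ⟨1, _, .add r a b s, le_rfl, rfl⟩ (by rintro _ rfl; exact h) (by omega)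

theorem sub_seq {r a b : ℕ} (h : Exec P (s.setReg r (s.reg a - s.reg b)) T Q) :
    Exec (.seq (.sub r a b) P) s (T + 1) Q :=
  seq (T₁ := 1) ⟨1, _, .sub r a b s, le_rfl, rfl⟩ (by rintro _ rfl; exact h) (by omega)

theorem load_seq {r a : ℕ} (h : Exec P (s.setReg r (s.mem (s.reg a))) T Q) :
    Exec (.seq (.load r a) P) s (T + 1) Q :=
  seq (T₁ := 1) ⟨1, _, .load r a s, le_rfl, rfl⟩ (by rintro _ rfl; exact h) (by omega)

theorem store_seq {a b : ℕ} (h : Exec P (s.setMem (s.reg a) (s.reg b)) T Q) :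
    Exec (.seq (.store a b) P) s (T + 1) Q :=
  seq (T₁ := 1) ⟨1, _, .store a b s, le_rfl, rfl⟩ (by rintro _ rfl; exact h) (by omega)

theorem cond {r : ℕ} (h₁ : s.reg r ≠ 0 → Exec P s T Q) (h₂ : s.reg r = 0 → Exec R s T Q) :
    Exec (.cond r P R) s (T + 1) Q := by
  by_cases h : s.reg r = 0
  · obtain ⟨t, s', h1, h2, h3⟩ := h₂ h
    exact ⟨_, s', .cond_false h h1, by omega, h3⟩
  · obtain ⟨t, s', h1, h2, h3⟩ := h₁ h
    exact ⟨_, s', .cond_true h h1, by omega, h3⟩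

theorem loop {r K : ℕ} {Inv : ℕ → RamState → Prop}
    (hend : ∀ s, Inv K s → s.reg r = 0)
    (hbody : ∀ j < K, ∀ s, Inv j s → s.reg r ≠ 0 ∧ Exec P s T (Inv (j + 1)))
    (h0 : Inv 0 s) : Exec (.loop r P) s (K * (T + 1) + 1) (Inv K) := by
  have key : ∀ i ≤ K, ∀ s, Inv (K - i) s → Exec (.loop r P) s (i * (T + 1) + 1) (Inv K) := by
    intro i
    induction i with
    | zero =>
      intro _ s hs
      exact ⟨1, s, .loop_false (hend s hs), by omega, hs⟩
    | succ i ih =>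
      intro hi s hs
      obtain ⟨h1, t, s', h2, h3, h4⟩ := hbody _ (by omega) s hs
      rw [show K - (i + 1) + 1 = K - i by omega] at h4
      obtain ⟨t', s'', h2', h3', h4'⟩ := ih (by omega) s' h4
      refine ⟨_, s'', .loop_true h1 h2 h2', ?_, h4'⟩
      rw [Nat.succ_mul]
      omega
  exact key K le_rfl s (by rwa [Nat.sub_self])

end Exec

/-- Repeat `P` as many times as register `N` says, with the counter `g`. Register `2` has to hold
`1`, and register `3` has to hold `0`. -/
def RamProg.repeat (g N : ℕ) (P : RamProg) : RamProg :=
  .seq (.add g N 3) (.loop g (.seq P (.sub g g 2)))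

/-- Each iteration costs the body, the decrement and a test; the initial copy and the final failing
test account for the summand `2`. -/
theorem Exec.repeat {P : RamProg} {s : RamState} {g N K T : ℕ} {Inv : ℕ → RamState → Prop}
    (hK : s.reg N = K) (h2 : s.reg 2 = 1) (h3 : s.reg 3 = 0) (hg : 2 < g)
    (h0 : Inv 0 (s.setReg g K))
    (hbody : ∀ j < K, ∀ s, Inv j s → s.reg 2 = 1 → s.reg g = K - j →
      Exec P s T fun s' => s'.reg 2 = 1 ∧ s'.reg g = K - j ∧
        Inv (j + 1) (s'.setReg g (K - (j + 1)))) :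
    Exec (.repeat g N P) s (K * (T + 2) + 2) (Inv K) := by
  have hg' : (2 : ℕ) ≠ g := hg.ne
  refine Exec.add_seq ?_
  refine (Exec.loop (K := K) (T := T + 1)
    (Inv := fun j s => Inv j s ∧ s.reg 2 = 1 ∧ s.reg g = K - j) ?_ ?_ ?_).mono ?_ fun s' h => h.1
  · rintro s ⟨-, -, h⟩
    omega
  · rintro j hj s ⟨h1, h2, h3⟩
    refine ⟨by omega, Exec.seq (hbody j hj s h1 h2 h3) (T₂ := 1) ?_ le_rfl⟩
    rintro s' ⟨h4, h5, h6⟩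
    refine ⟨1, _, .sub g g 2 s', le_rfl, ?_⟩
    have h7 : s'.reg g - s'.reg 2 = K - (j + 1) := by omega
    rw [h7]
    exact ⟨h6, by simp [hg', h4], by simp⟩
  · rw [hK, h3, add_zero]
    exact ⟨h0, by simp [hg', h2], by simp⟩
  · ring_nf; omega

/-- The registers below `k` have the same values in both states. -/
def Frame (k : ℕ) (s s' : RamState) : Prop := ∀ r < k, s'.reg r = s.reg r

theorem Frame.refl (k : ℕ) (s : RamState) : Frame k s s := fun _ _ => rfl

theorem Frame.trans {k : ℕ} {s s' s'' : RamState} (h : Frame k s s') (h' : Frame k s' s'') :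
    Frame k s s'' := fun r hr => (h' r hr).trans (h r hr)

theorem Frame.mono {k l : ℕ} {s s' : RamState} (h : Frame k s s') (hl : l ≤ k) : Frame l s s' :=
  fun r hr => h r (by omega)

@[simp] theorem frame_setReg {k r v : ℕ} {s s' : RamState} (h : k ≤ r) :
    Frame k s (s'.setReg r v) ↔ Frame k s s' := by
  refine forall_congr' fun i => forall_congr' fun hi => ?_
  rw [RamState.reg_setReg, if_neg (by omega)]

@[simp] theorem setReg_frame {k r v : ℕ} {s s' : RamState} (h : k ≤ r) :
    Frame k (s.setReg r v) s' ↔ Frame k s s' := by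
  refine forall_congr' fun i => forall_congr' fun hi => ?_
  rw [RamState.reg_setReg, if_neg (by omega)]

@[simp] theorem frame_setMem {k a v : ℕ} {s s' : RamState} :
    Frame k s (s'.setMem a v) ↔ Frame k s s' := Iff.rfl

/-- The registers that hold constants while the refinement runs. -/
structure HasConstants (n : ℕ) (s : RamState) : Prop where
  reg_zero : s.reg 0 = n
  reg_two : s.reg 2 = 1
  reg_three : s.reg 3 = 0
  reg_four : s.reg 4 = n * n
  reg_five : s.reg 5 = numCells n

/-- Between the set-up of the constants and the final test only registers from `6` on are written,
and inner programs write only higher registers than the loop variables around them. -/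
theorem HasConstants.of_frame {n k : ℕ} {s s' : RamState} (h : HasConstants n s)
    (hf : Frame k s s') (hk : 6 ≤ k) : HasConstants n s' :=
  ⟨by rw [hf 0 (by omega), h.1], by rw [hf 2 (by omega), h.2], by rw [hf 3 (by omega), h.3],
    by rw [hf 4 (by omega), h.4], by rw [hf 5 (by omega), h.5]⟩

end Machine

/-! ### The program for colour refinement -/

section Program

variable {n : ℕ}

theorem countPairs_succ (c : ℕ → ℕ) (row col α β j : ℕ) :
    countPairs n c row col α β (j + 1) =
      countPairs n c row col α β j + if c (row + j) = α ∧ c (col + j * n) = β then 1 else 0 := by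
  unfold countPairs
  rw [Finset.card_filter, Finset.card_filter, Finset.sum_range_succ]

/-- Register `40` becomes `n + 1` times its value plus the number of pairs of the colours in the
registers `15` and `18` on the row at register `8` and the column at register `10`. -/
def countProg : RamProg :=
  .seq (.add 19 40 3) <| .seq (.add 20 8 3) <| .seq (.add 21 10 3) <| .repeat 22 0 <|
    .seq (.load 23 20) <| .seq (.load 24 21) <|
    -- The sum of the two truncated differences is the distance; register `25` ends up zero exactly
    -- when both colours match.
    .seq (.sub 25 23 15) <| .seq (.sub 26 15 23) <| .seq (.add 25 25 26) <|
    .seq (.sub 26 24 18) <| .seq (.add 25 25 26) <|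
    .seq (.sub 26 18 24) <| .seq (.add 25 25 26) <|
    -- A step along the row is `1`, along the column `n`. Adding the saved colour once per vertex
    -- multiplies it by `n + 1` in total.
    .seq (.add 20 20 2) <| .seq (.add 21 21 0) <| .seq (.add 40 40 19) <|
    -- The first branch does nothing of effect: register `25` is recomputed in each iteration.
    .cond 25 (.const 25 0) (.add 40 40 2)

theorem exec_countProg {s : RamState} (hs : HasConstants n s) :
    Exec countProg s (n * 16 + 5) fun s' => s'.mem = s.mem ∧ Frame 19 s s' ∧
      s'.reg 40 = (n + 1) * s.reg 40 +
        countPairs n s.mem (s.reg 8) (s.reg 10) (s.reg 15) (s.reg 18) n := by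
  refine .add_seq <| .add_seq <| .add_seq ?_
  refine (Exec.repeat (K := n) (T := 14) (Inv := fun j s' => s'.mem = s.mem ∧ Frame 19 s s' ∧
    s'.reg 19 = s.reg 40 ∧ s'.reg 20 = s.reg 8 + j ∧ s'.reg 21 = s.reg 10 + j * n ∧
    s'.reg 40 = (j + 1) * s.reg 40 +
        countPairs n s.mem (s.reg 8) (s.reg 10) (s.reg 15) (s.reg 18) j)
    ?_ ?_ ?_ (by norm_num) ?_ ?_).mono le_rfl ?_
  · simp [hs.1]
  · simp [hs.2]
  · simp [hs.3]
  · simp [hs.3, Frame.refl, countPairs]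
  · rintro j hj s' ⟨hm, hf, h19, h20, h21, h40⟩ h2 h22
    have h0 : s'.reg 0 = n := (hf 0 (by norm_num)).trans hs.1
    have h15 := hf 15 (by norm_num)
    have h18 := hf 18 (by norm_num)
    refine .load_seq <| .load_seq <| .sub_seq <| .sub_seq <| .add_seq <| .sub_seq <| .add_seq <|
      .sub_seq <| .add_seq <| .add_seq <| .add_seq <| .add_seq <| .cond (fun h => .const ?_)
      (fun h => .add ?_)
    all_goals
      simp [hm, h19, h20, h21, h40, h0, h15, h18, h2] at h
      simp [hm, h19, h20, h21, h40, h0, h15, h18, h2, h22, hf, countPairs_succ]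
      refine ⟨by ring, by ring, ?_⟩
    · rw [if_neg (by omega)]
      ring
    · rw [if_pos (by omega)]
      ring
  · rintro s' ⟨hm, hf, -, -, -, h40⟩
    exact ⟨hm, hf, h40⟩

/-- Append to register `40` the numbers of pairs of the colour in register `15` and any other. -/
def digitsProg : RamProg :=
  .seq (.const 16 0) <| .repeat 17 5 <|
    .seq (.load 18 16) <| .seq (.add 16 16 2) countProg

/-- The running time of `digitsProg`. -/
def digitsTime (n : ℕ) : ℕ := (n * n + n * n) * (n * 16 + 9) + 3

theorem exec_digitsProg {s : RamState} (hs : HasConstants n s) :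
    Exec digitsProg s (digitsTime n) fun s' => s'.mem = s.mem ∧ Frame 16 s s' ∧
      s'.reg 40 = appendDigits (n + 1) (fun b => countPairs n s.mem (s.reg 8) (s.reg 10)
        (s.reg 15) (s.mem b) n) (s.reg 40) (numCells n) := by
  refine .const_seq ?_
  refine (Exec.repeat (K := numCells n) (T := n * 16 + 7) (Inv := fun j s' => s'.mem = s.mem ∧
    Frame 16 s s' ∧ s'.reg 16 = j ∧
    s'.reg 40 = appendDigits (n + 1) (fun b => countPairs n s.mem (s.reg 8) (s.reg 10)
        (s.reg 15) (s.mem b) n) (s.reg 40) j)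
    ?_ ?_ ?_ (by norm_num) ?_ ?_).mono le_rfl ?_
  · simp [hs.5]
  · simp [hs.2]
  · simp [hs.3]
  · simp [Frame.refl, appendDigits]
  · rintro j hj s' ⟨hm, hf, h16, h40⟩ h2 h17
    refine .load_seq <| .add_seq ?_
    refine (exec_countProg (n := n) ?_).mono le_rfl ?_
    · exact hs.of_frame (k := 16) (by simp [hf]) (by norm_num)
    · rintro s'' ⟨hm', hf', h40'⟩
      have h2' := hf' 2 (by norm_num)
      have h16' := hf' 16 (by norm_num)
      have h17' := hf' 17 (by norm_num)
      simp [h2, h16, h17, h40, hm, hf 8, hf 10, hf 15] at hm' h2' h16' h17' h40'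
      have hf'' : Frame 16 s s'' := hf.trans (by simpa using hf'.mono (l := 16) (by norm_num))
      simp [hm', h2', h16', h17', h40', hf'', appendDigits]
  · rintro s' ⟨hm, hf, -, h40⟩
    exact ⟨hm, hf, h40⟩

/-- Append to register `40` the numbers of pairs of all colours. -/
def countsProg : RamProg :=
  .seq (.const 13 0) <| .repeat 14 5 <|
    .seq (.load 15 13) <| .seq (.add 13 13 2) digitsProg

/-- The running time of `countsProg`. -/
def countsTime (n : ℕ) : ℕ :=
  (n * n + n * n) * (digitsTime n + 4) + 3

theorem exec_countsProg {s : RamState} (hs : HasConstants n s) :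
    Exec countsProg s (countsTime n) fun s' => s'.mem = s.mem ∧ Frame 13 s s' ∧
      s'.reg 40 = appendCounts n s.mem (s.reg 8) (s.reg 10) (s.reg 40) (numCells n) := by
  refine .const_seq ?_
  refine (Exec.repeat (K := numCells n) (T := digitsTime n + 2) (Inv := fun j s' =>
    s'.mem = s.mem ∧ Frame 13 s s' ∧ s'.reg 13 = j ∧
    s'.reg 40 = appendCounts n s.mem (s.reg 8) (s.reg 10) (s.reg 40) j)
    ?_ ?_ ?_ (by norm_num) ?_ ?_).mono le_rfl ?_
  · simp [hs.5]
  · simp [hs.2]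
  · simp [hs.3]
  · simp [Frame.refl, appendCounts]
  · rintro j hj s' ⟨hm, hf, h13, h40⟩ h2 h14
    refine .load_seq <| .add_seq ?_
    refine (exec_digitsProg (n := n) ?_).mono le_rfl ?_
    · exact hs.of_frame (k := 13) (by simp [hf]) (by norm_num)
    · rintro s'' ⟨hm', hf', h40'⟩
      have h2' := hf' 2 (by norm_num)
      have h13' := hf' 13 (by norm_num)
      have h14' := hf' 14 (by norm_num)
      simp [h2, h13, h14, h40, hm, hf 8, hf 10] at hm' h2' h13' h14' h40'
      have hf'' : Frame 13 s s'' := hf.trans (by simpa using hf'.mono (l := 13) (by norm_num))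
      simp [hm', h2', h13', h14', h40', hf'', appendCounts]
  · rintro s' ⟨hm, hf, -, h40⟩
    exact ⟨hm, hf, h40⟩

/-- The memory holds the colouring `c`, followed by the first `p` cells of its refinement. -/
def HoldsColoring (n : ℕ) (c : ℕ → ℕ) (p : ℕ) (s : RamState) : Prop :=
  (∀ k < numCells n, s.mem k = c k) ∧ ∀ k < p, s.mem (numCells n + k) = refine n c k

@[simp] theorem holdsColoring_setReg {c : ℕ → ℕ} {p : ℕ} {s : RamState} {r v : ℕ} :
    HoldsColoring n c p (s.setReg r v) ↔ HoldsColoring n c p s := Iff.rfl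

/-- Refine the row at register `8` of the graph at register `7`. -/
def rowProg : RamProg :=
  .seq (.add 10 7 3) <| .seq (.add 11 8 3) <| .repeat 12 0 <|
    .seq (.load 40 11) <| .seq countsProg <| .seq (.add 41 11 5) <| .seq (.store 41 40) <|
    .seq (.add 10 10 2) (.add 11 11 2)

/-- The running time of `rowProg`. -/
def rowTime (n : ℕ) : ℕ := n * (countsTime n + 7) + 4

theorem exec_rowProg {c : ℕ → ℕ} {i u : ℕ} (hi : i < 2) (hu : u < n) {s : RamState}
    (hs : HasConstants n s) (h7 : s.reg 7 = i * (n * n)) (h8 : s.reg 8 = i * (n * n) + u * n)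
    (hc : HoldsColoring n c (i * (n * n) + u * n) s) :
    Exec rowProg s (rowTime n) fun s' => Frame 10 s s' ∧
      HoldsColoring n c (i * (n * n) + u * n + n) s' := by
  refine .add_seq <| .add_seq ?_
  refine (Exec.repeat (K := n) (T := countsTime n + 5) (Inv := fun j s' => Frame 10 s s' ∧
    s'.reg 10 = i * (n * n) + j ∧ s'.reg 11 = i * (n * n) + u * n + j ∧
    HoldsColoring n c (i * (n * n) + u * n + j) s')
    ?_ ?_ ?_ (by norm_num) ?_ ?_).mono le_rfl ?_
  · simp [hs.1]
  · simp [hs.2]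
  · simp [hs.3]
  · simpa [Frame.refl, hs.3, h7, h8] using hc
  · rintro j hj s' ⟨hf, h10, h11, hc'⟩ h2 h12
    have hlt : i * (n * n) + u * n + j < numCells n := cell_lt ⟨i, hi⟩ ⟨u, hu⟩ ⟨j, hj⟩
    refine .load_seq ?_
    refine (exec_countsProg (n := n) ?_).seq (T₂ := 4) ?_ (by omega)
    · exact hs.of_frame (k := 10) (by simp [hf]) (by norm_num)
    rintro s'' ⟨hm', hf', h40'⟩
    have h2' := hf' 2 (by norm_num)
    have h5' := hf' 5 (by norm_num)
    have h10' := hf' 10 (by norm_num)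
    have h11' := hf' 11 (by norm_num)
    have h12' := hf' 12 (by norm_num)
    have hf'' : Frame 10 s s'' := hf.trans (by simpa using hf'.mono (l := 10) (by norm_num))
    simp [h2, h10, h11, h12, hf 8, h8, hf 5, hs.5] at hm' h2' h5' h10' h11' h12' h40'
    -- The memory agrees with `c` only below `numCells n`, as refined colours are stored above;
    -- refinement reads nothing beyond those cells.
    rw [← refine_cell_of_lt s'.mem hu hj, refine_congr hc'.1 hlt] at h40'
    refine .add_seq <| .store_seq <| .add_seq <| .add ?_
    simp [h2', h5', h10', h11', h12', h40', hf'']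
    refine ⟨by ring, by ring, ?_, ?_⟩
    · intro k hk
      simp only [RamState.mem_setReg, RamState.mem_setMem]
      rw [if_neg (by omega), hm']
      exact hc'.1 k hk
    · intro k hk
      simp only [RamState.mem_setReg, RamState.mem_setMem]
      split_ifs with h
      · rw [show k = i * (n * n) + u * n + j by omega]
      · rw [hm']
        exact hc'.2 k (by omega)
  · rintro s' ⟨hf, -, -, h⟩
    exact ⟨hf, h⟩

/-- Refine the colours of the graph at register `7`. -/
def sideProg : RamProg :=
  .seq (.add 8 7 3) <| .repeat 9 0 <| .seq rowProg (.add 8 8 0)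

/-- The running time of `sideProg`. -/
def sideTime (n : ℕ) : ℕ := n * (rowTime n + 3) + 3

theorem exec_sideProg {c : ℕ → ℕ} {i : ℕ} (hi : i < 2) {s : RamState}
    (hs : HasConstants n s) (h7 : s.reg 7 = i * (n * n))
    (hc : HoldsColoring n c (i * (n * n)) s) :
    Exec sideProg s (sideTime n) fun s' => Frame 8 s s' ∧
      HoldsColoring n c (i * (n * n) + n * n) s' := by
  unfold sideTime
  refine .add_seq ?_
  refine (Exec.repeat (K := n) (T := rowTime n + 1) (Inv := fun u s' => Frame 8 s s' ∧
    s'.reg 8 = i * (n * n) + u * n ∧ HoldsColoring n c (i * (n * n) + u * n) s')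
    ?_ ?_ ?_ (by norm_num) ?_ ?_).mono le_rfl ?_
  · simp [hs.1]
  · simp [hs.2]
  · simp [hs.3]
  · simpa [Frame.refl, hs.3, h7] using hc
  · rintro u hu s' ⟨hf, h8, hc'⟩ h2 h9
    refine (exec_rowProg hi hu ?_ ?_ h8 hc').seq (T₂ := 1) ?_ le_rfl
    · exact hs.of_frame hf (by norm_num)
    · rw [hf 7 (by norm_num), h7]
    rintro s'' ⟨hf', hc''⟩
    have h0' := (hf' 0 (by norm_num)).trans ((hf 0 (by norm_num)).trans hs.1)
    have h2' := (hf' 2 (by norm_num)).trans h2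
    have h8' := (hf' 8 (by norm_num)).trans h8
    have h9' := (hf' 9 (by norm_num)).trans h9
    have hf'' : Frame 8 s s'' := hf.trans (hf'.mono (by norm_num))
    refine .add ?_
    simp [h0', h2', h8', h9', hf'']
    refine ⟨by ring, ?_⟩
    rw [Nat.succ_mul, ← add_assoc]
    exact hc''
  · rintro s' ⟨hf, -, h⟩
    exact ⟨hf, h⟩

/-- Replace the colours by the refined colours. -/
def copyProg : RamProg :=
  .seq (.const 8 0) <| .repeat 9 5 <|
    .seq (.add 10 8 5) <| .seq (.load 11 10) <| .seq (.store 8 11) (.add 8 8 2)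

theorem exec_copyProg {c : ℕ → ℕ} {s : RamState} (hs : HasConstants n s)
    (hc : ∀ k < numCells n, s.mem (numCells n + k) = c k) :
    Exec copyProg s (numCells n * 6 + 3) fun s' => Frame 8 s s' ∧
      ∀ k < numCells n, s'.mem k = c k := by
  refine .const_seq ?_
  refine (Exec.repeat (K := numCells n) (T := 4) (Inv := fun j s' => Frame 8 s s' ∧
    s'.reg 8 = j ∧ (∀ k < numCells n, s'.mem (numCells n + k) = c k) ∧ ∀ k < j, s'.mem k = c k)
    ?_ ?_ ?_ (by norm_num) ?_ ?_).mono le_rfl ?_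
  · simp [hs.5]
  · simp [hs.2]
  · simp [hs.3]
  · simpa [Frame.refl] using hc
  · rintro j hj s' ⟨hf, h8, hc', hj'⟩ h2 h9
    have h5 := (hf 5 (by norm_num)).trans hs.5
    refine .add_seq <| .load_seq <| .store_seq <| .add ?_
    simp [h2, h5, h8, h9, hf]
    rw [add_comm j, hc' j hj]
    refine ⟨fun k hk => ?_, fun k hk => ?_⟩
    · rw [if_neg (by omega), hc' k hk]
    · split_ifs with h
      · rw [h]
      · exact hj' k (by omega)
  · rintro s' ⟨hf, -, -, h⟩
    exact ⟨hf, h⟩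

/-- One round of colour refinement. -/
def roundProg : RamProg :=
  .seq (.const 7 0) <| .seq sideProg <| .seq (.add 7 4 3) <| .seq sideProg copyProg

/-- The running time of `roundProg`. -/
def roundTime (n : ℕ) : ℕ :=
  sideTime n + sideTime n + (n * n + n * n) * 6 + 5

theorem exec_roundProg {c : ℕ → ℕ} {s : RamState} (hs : HasConstants n s)
    (hc : ∀ k < numCells n, s.mem k = c k) :
    Exec roundProg s (roundTime n) fun s' => Frame 7 s s' ∧
      ∀ k < numCells n, s'.mem k = refine n c k := by
  unfold roundTime
  refine .const_seq ?_
  refine (exec_sideProg (n := n) (c := c) (i := 0) (by norm_num) ?_ ?_ ?_).seq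
    (T₂ := sideTime n + numCells n * 6 + 4) ?_ ?_
  · exact hs.of_frame (k := 7) (by simp [Frame.refl]) (by norm_num)
  · simp
  · exact ⟨hc, fun k hk => by omega⟩
  · rintro s₁ ⟨hf₁, hc₁⟩
    have hf₁' : Frame 7 s s₁ := by simpa using hf₁.mono (l := 7) (by norm_num)
    have hs₁ := hs.of_frame hf₁' (by norm_num)
    refine .add_seq ?_
    refine (exec_sideProg (n := n) (c := c) (i := 1) (by norm_num) ?_ ?_ ?_).seq
      (T₂ := numCells n * 6 + 3) ?_ (by omega)
    · exact hs₁.of_frame (k := 7) (by simp [Frame.refl]) (by norm_num)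
    · simp [hs₁.3, hs₁.4]
    · simpa [HoldsColoring] using hc₁
    · rintro s₂ ⟨hf₂, hc₂⟩
      have hf₂' : Frame 7 s₁ s₂ := by simpa using hf₂.mono (l := 7) (by norm_num)
      have hs₂ := hs₁.of_frame hf₂' (by norm_num)
      refine (exec_copyProg (c := refine n c) hs₂ ?_).mono le_rfl ?_
      · intro k hk
        refine hc₂.2 k ?_
        rwa [one_mul]
      · rintro s₃ ⟨hf₃, hc₃⟩
        exact ⟨(hf₁'.trans hf₂').trans (hf₃.mono (by norm_num)), hc₃⟩
  · simp only [numCells]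
    omega

/-- Colour refinement until it is stable. -/
def refineProg : RamProg := .repeat 6 5 roundProg

/-- The running time of `refineProg`. -/
def refineTime (n : ℕ) : ℕ := (n * n + n * n) * (roundTime n + 2) + 2

theorem exec_refineProg {c : ℕ → ℕ} {s : RamState} (hs : HasConstants n s)
    (hc : ∀ k < numCells n, s.mem k = c k) :
    Exec refineProg s (refineTime n) fun s' => Frame 6 s s' ∧
      ∀ k < numCells n, s'.mem k = (refine n)^[numCells n] c k := by
  refine (Exec.repeat (K := numCells n) (T := roundTime n) (Inv := fun j s' => Frame 6 s s' ∧
    ∀ k < numCells n, s'.mem k = (refine n)^[j] c k)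
    hs.5 hs.2 hs.3 (by norm_num) ?_ ?_).mono le_rfl fun s' h => h
  · simpa [Frame.refl] using hc
  · rintro j hj s' ⟨hf, hc'⟩ h2 h6
    refine (exec_roundProg (hs.of_frame hf (by norm_num)) hc').mono le_rfl ?_
    rintro s'' ⟨hf', hc''⟩
    have h2' := (hf' 2 (by norm_num)).trans h2
    have h6' := (hf' 6 (by norm_num)).trans h6
    have hf'' : Frame 6 s s'' := hf.trans (hf'.mono (by norm_num))
    simp only [Function.iterate_succ_apply']
    simp [h2', h6', hf'']
    exact hc''

/-! ### Preparing the input and the final test -/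

/-- Write the initial colours of the diagonal cells of the graph at register `7`. -/
def diagProg : RamProg :=
  .seq (.const 8 2) <| .repeat 6 0 <|
    -- Consecutive diagonal cells are `n + 1` apart.
    .seq (.store 7 8) <| .seq (.add 7 7 0) (.add 7 7 2)

open Classical in
theorem exec_diagProg {s : RamState} (hs : HasConstants n s) :
    Exec diagProg s (n * 5 + 3) fun s' => Frame 6 s s' ∧
      ∀ k, s'.mem k = if ∃ i < n, k = s.reg 7 + i * (n + 1) then 2 else s.mem k := by
  refine .const_seq ?_
  refine (Exec.repeat (K := n) (T := 3) (Inv := fun j s' => Frame 6 s s' ∧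
    s'.reg 7 = s.reg 7 + j * (n + 1) ∧ s'.reg 8 = 2 ∧
      ∀ k, s'.mem k = if ∃ i < j, k = s.reg 7 + i * (n + 1) then 2 else s.mem k)
    ?_ ?_ ?_ (by norm_num) ?_ ?_).mono le_rfl ?_
  · simp [hs.1]
  · simp [hs.2]
  · simp [hs.3]
  · simp [Frame.refl]
  · rintro j hj s' ⟨hf, h7, h8, hm⟩ h2 h6
    have h0 := (hf 0 (by norm_num)).trans hs.1
    refine .store_seq <| .add_seq <| .add ?_
    simp [h0, h2, h6, h7, h8, hf]
    refine ⟨by ring, fun k => ?_⟩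
    simp only [Nat.le_iff_lt_or_eq, or_and_right, exists_or, exists_eq_left]
    rw [hm]
    by_cases h : ∃ i < j, k = s.reg 7 + i * (n + 1) <;>
      by_cases h' : k = s.reg 7 + j * (n + 1) <;>
      simp only [h, h', if_true, if_false, or_true, true_or, or_self]
  · rintro s' ⟨hf, -, -, h⟩
    exact ⟨hf, h⟩

/-- Decide whether the colour of the first cell of the second graph occurs in the first graph. -/
def testProg : RamProg :=
  .seq (.load 8 4) <| .seq (.const 9 0) <| .seq (.const 0 0) <| .repeat 10 4 <|
    .seq (.load 11 9) <| .seq (.sub 12 11 8) <| .seq (.sub 13 8 11) <| .seq (.add 12 12 13) <|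
    .seq (.add 9 9 2) <| .cond 12 (.const 12 0) (.const 0 1)

open Classical in
theorem exec_testProg {s : RamState} (hs : HasConstants n s) :
    Exec testProg s (n * n * 9 + 5) fun s' =>
      s'.reg 0 = if ∃ p < n * n, s.mem p = s.mem (n * n) then 1 else 0 := by
  refine .load_seq <| .const_seq <| .const_seq ?_
  refine (Exec.repeat (K := n * n) (T := 7) (Inv := fun j s' => s'.mem = s.mem ∧
    s'.reg 8 = s.mem (n * n) ∧ s'.reg 9 = j ∧
    s'.reg 0 = if ∃ p < j, s.mem p = s.mem (n * n) then 1 else 0)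
    ?_ ?_ ?_ (by norm_num) ?_ ?_).mono le_rfl ?_
  · simp [hs.4]
  · simp [hs.2]
  · simp [hs.3]
  · simp [hs.4]
  · rintro j hj s' ⟨hm, h8, h9, h0⟩ h2 h10
    refine .load_seq <| .sub_seq <| .sub_seq <| .add_seq <| .add_seq <|
      .cond (fun h => .const ?_) (fun h => .const ?_)
    all_goals
      simp [hm, h8, h9] at h
      simp [hm, h8, h9, h10, h2, h0]
    · have hne : s.mem j ≠ s.mem (n * n) := fun e => by omega
      simp only [Nat.le_iff_lt_or_eq, or_and_right, exists_or, exists_eq_left, hne, or_false]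
    · exact ⟨j, le_rfl, by omega⟩
  · rintro s' ⟨-, -, -, h⟩
    exact h

/-- Set up the constants, for graphs with the same number of vertices. -/
def constProg : RamProg :=
  -- The square `n * n` is obtained by adding `n` to itself, as the machine cannot multiply.
  .seq (.repeat 6 0 (.add 4 4 0)) (.add 5 4 4)

theorem exec_constProg {s : RamState} (h0 : s.reg 0 = n) (h2 : s.reg 2 = 1) (h3 : s.reg 3 = 0)
    (h4 : s.reg 4 = 0) :
    Exec constProg s (n * 3 + 3) fun s' => s'.mem = s.mem ∧ HasConstants n s' := by
  refine (Exec.repeat (K := n) (T := 1) (Inv := fun j s' => s'.mem = s.mem ∧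
    s'.reg 0 = n ∧ s'.reg 2 = 1 ∧ s'.reg 3 = 0 ∧ s'.reg 4 = j * n)
    h0 h2 h3 (by norm_num) ?_ ?_).seq (T₂ := 1) ?_ le_rfl
  · simp [h0, h2, h3, h4]
  · rintro j hj s' ⟨hm, h0, h2, h3, h4⟩ - h6
    refine .add ?_
    simp [hm, h0, h2, h3, h4, h6]
    ring
  · rintro s' ⟨hm, h0, h2, h3, h4⟩
    refine .add ⟨hm, ?_, ?_, ?_, ?_, ?_⟩ <;> simp [h0, h2, h3, h4, numCells]

/-- Decide equivalence of two nonempty graphs with the same number of vertices. -/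
def equalCardProg : RamProg :=
  .seq constProg <| .seq (.const 7 0) <| .seq diagProg <| .seq (.add 7 4 3) <| .seq diagProg <|
    .seq refineProg testProg

/-- The running time of `equalCardProg`. -/
def equalCardTime (n : ℕ) : ℕ :=
  n * 13 + refineTime n + n * n * 9 + 16

theorem cell_inj {s t : Fin 2} {u v u' v' : Fin n} (h : cell n s u v = cell n t u' v') :
    s = t ∧ u = u' ∧ v = v' := by
  have key : ∀ {a b a' b' : ℕ}, b < n → b' < n → a * n + b = a' * n + b' → a = a' ∧ b = b' := by
    intro a b a' b' hb hb' h
    have hn : 0 < n := by omega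
    have h1 := congrArg (· / n) h
    have h2 := congrArg (· % n) h
    simp only [mul_comm _ n, Nat.mul_add_div hn, Nat.div_eq_of_lt hb, Nat.div_eq_of_lt hb',
      add_zero] at h1
    simp only [mul_comm _ n, Nat.mul_add_mod, Nat.mod_eq_of_lt hb, Nat.mod_eq_of_lt hb'] at h2
    exact ⟨h1, h2⟩
  unfold cell at h
  rw [← mul_assoc, ← mul_assoc, ← add_mul, ← add_mul] at h
  obtain ⟨h1, h2⟩ := key v.2 v'.2 h
  obtain ⟨h3, h4⟩ := key u.2 u'.2 h1
  exact ⟨Fin.ext h3, Fin.ext h4, Fin.ext h2⟩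

open Classical in
theorem inputState_mem_cell (X Y : SimpleGraph (Fin n)) (s : Fin 2) (u v : Fin n) :
    (inputState X Y).mem (cell n s u v) = if (![X, Y] s).Adj u v then 1 else 0 := by
  have h0 : ∀ i j : Fin n, (i : ℕ) * n + j = cell n 0 i j := fun i j => by simp [cell]
  have h1 : ∀ i j : Fin n, n * n + ((i : ℕ) * n + j) = cell n 1 i j := fun i j => by
    simp [cell, add_assoc]
  simp only [inputState, h1]
  simp only [h0]
  refine if_congr ?_ rfl rfl
  constructor
  · rintro (⟨i, j, h, ha⟩ | ⟨i, j, h, ha⟩)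
    · obtain ⟨rfl, rfl, rfl⟩ := cell_inj h
      exact ha
    · obtain ⟨rfl, rfl, rfl⟩ := cell_inj h
      exact ha
  · intro h
    fin_cases s
    · exact Or.inl ⟨u, v, rfl, h⟩
    · exact Or.inr ⟨u, v, rfl, h⟩

theorem exec_equalCardProg (hn : 0 < n) {X Y : SimpleGraph (Fin n)} {s : RamState}
    (hm : s.mem = (inputState X Y).mem) (h0 : s.reg 0 = n) (h2 : s.reg 2 = 1) (h3 : s.reg 3 = 0)
    (h4 : s.reg 4 = 0) :
    Exec equalCardProg s (equalCardTime n) fun s' =>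
      (GraphEquivalent X Y → s'.reg 0 = 1) ∧ (¬ GraphEquivalent X Y → s'.reg 0 = 0) := by
  classical
  refine (exec_constProg h0 h2 h3 h4).seq
    (T₂ := n * 10 + refineTime n + n * n * 9 + 13) ?_ ?_
  · rintro s₁ ⟨hm₁, hs₁⟩
    refine .const_seq <| (exec_diagProg (n := n) ?_).seq
      (T₂ := n * 5 + refineTime n + n * n * 9 + 9) ?_ (by omega)
    · exact hs₁.of_frame (k := 6) (by simp [Frame.refl]) (by norm_num)
    rintro s₂ ⟨hf₂, hm₂⟩
    have hs₂ : HasConstants n s₂ := hs₁.of_frame (by simpa using hf₂) (by norm_num)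
    refine .add_seq <| (exec_diagProg (n := n) ?_).seq
      (T₂ := refineTime n + n * n * 9 + 5) ?_ (by omega)
    · exact hs₂.of_frame (k := 6) (by simp [Frame.refl]) (by norm_num)
    rintro s₃ ⟨hf₃, hm₃⟩
    have hs₃ : HasConstants n s₃ := hs₂.of_frame (by simpa using hf₃) (by norm_num)
    have hdiag : ∀ (t : Fin 2) (i : ℕ) (hi : i < n),
        (t : ℕ) * (n * n) + i * (n + 1) = cell n t ⟨i, hi⟩ ⟨i, hi⟩ := by
      intro t i hi
      simp only [cell]
      ring
    have hmem : ∀ (t s : Fin 2) (u v : Fin n),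
        (∃ i < n, cell n s u v = (t : ℕ) * (n * n) + i * (n + 1)) ↔ s = t ∧ u = v := by
      intro t s u v
      constructor
      · rintro ⟨i, hi, h⟩
        rw [hdiag t i hi] at h
        obtain ⟨rfl, rfl, rfl⟩ := cell_inj h
        exact ⟨rfl, rfl⟩
      · rintro ⟨rfl, rfl⟩
        exact ⟨u, u.2, (hdiag s u u.2).symm⟩
    have hinit : IsInitialColoring X Y s₃.mem := by
      intro t u v
      have e0 := hmem 0 t u v
      have e1 := hmem 1 t u v
      simp only [Fin.coe_ofNat_eq_mod, Nat.zero_mod, zero_mul, zero_add] at e0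
      simp only [Fin.coe_ofNat_eq_mod, Nat.one_mod, one_mul] at e1
      rw [hm₃]
      simp only [RamState.reg_setReg, RamState.mem_setReg, if_true, hs₂.3, hs₂.4, add_zero, e1]
      rw [hm₂]
      simp only [RamState.reg_setReg, RamState.mem_setReg, if_true, zero_add, e0]
      rw [hm₁, hm, inputState_mem_cell]
      fin_cases t <;> by_cases huv : u = v <;> simp [huv]
    refine (exec_refineProg (c := s₃.mem) hs₃ fun _ _ => rfl).seq
      (T₂ := n * n * 9 + 5) ?_ (by omega)
    rintro s₄ ⟨hf₄, hm₄⟩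
    refine (exec_testProg (hs₃.of_frame hf₄ (by norm_num))).mono le_rfl ?_
    intro s₅ h5
    have hiff : GraphEquivalent X Y ↔ ∃ p < n * n, s₄.mem p = s₄.mem (n * n) := by
      rw [graphEquivalent_iff_exists_color_eq hn hinit]
      have hpos : 0 < n * n := Nat.mul_pos hn hn
      refine exists_congr fun p => and_congr_right fun hp => ?_
      rw [hm₄ p (by unfold numCells; omega), hm₄ (n * n) (by unfold numCells; omega)]
    rw [h5]
    exact ⟨fun h => if_pos (hiff.1 h), fun h => if_neg (mt hiff.2 h)⟩
  · unfold equalCardTime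
    omega

/-- Decide equivalence of two graphs. -/
def equivalentProg : RamProg :=
  .seq (.const 2 1) <| .seq (.sub 6 0 1) <| .seq (.sub 7 1 0) <| .seq (.add 6 6 7) <|
    -- Register `6` holds the distance of `n` and `m`. Two empty graphs are accepted separately,
    -- since they have no cell to test.
    .cond 6 (.const 0 0) (.cond 0 equalCardProg (.const 0 1))

theorem graphEquivalent_of_isEmpty {V : Type u} {W : Type v} [Fintype V] [DecidableEq V]
    [Fintype W] [DecidableEq W] [IsEmpty V] [IsEmpty W] (X : SimpleGraph V) (Y : SimpleGraph W) :
    GraphEquivalent X Y :=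
  graphEquivalent_of_starSubalgebra ⊤ trivial (fun _ _ _ _ => trivial) trivial
    (fun _ _ _ => Subsingleton.elim _ _) (fun _ _ _ => Subsingleton.elim _ _)

theorem exec_equivalentProg {n m : ℕ} (X : SimpleGraph (Fin n)) (Y : SimpleGraph (Fin m)) :
    Exec equivalentProg (inputState X Y) (equalCardTime n + 6) fun s' =>
      (GraphEquivalent X Y → s'.reg 0 = 1) ∧ (¬ GraphEquivalent X Y → s'.reg 0 = 0) := by
  have hr0 : (inputState X Y).reg 0 = n := rfl
  have hr1 : (inputState X Y).reg 1 = m := rfl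
  refine .const_seq <| .sub_seq <| .sub_seq <| .add_seq <| .cond (fun h => .const ?_) fun h =>
    .cond (fun h' => ?_) fun h' => ?_
  · simp [hr0, hr1] at h ⊢
    intro hXY
    have := hXY.card_eq
    rw [Fintype.card_fin, Fintype.card_fin] at this
    omega
  · simp [hr0, hr1] at h h'
    obtain rfl : n = m := by omega
    refine exec_equalCardProg (by omega) ?_ ?_ ?_ ?_ ?_ <;> simp [inputState]
  · simp [hr0, hr1] at h h'
    obtain rfl : n = m := by omega
    subst h'
    refine .const ⟨fun _ => by simp, fun h => absurd (graphEquivalent_of_isEmpty X Y) h⟩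

/-! ### The polynomial time bound -/

/-- A function that is given by a polynomial with natural coefficients. -/
def IsPolynomial (f : ℕ → ℕ) : Prop := ∃ p : Polynomial ℕ, ∀ n, p.eval n = f n

theorem IsPolynomial.add {f g : ℕ → ℕ} (hf : IsPolynomial f) (hg : IsPolynomial g) :
    IsPolynomial fun n => f n + g n := by
  obtain ⟨p, hp⟩ := hf
  obtain ⟨q, hq⟩ := hg
  exact ⟨p + q, fun n => by rw [Polynomial.eval_add, hp, hq]⟩

theorem IsPolynomial.mul {f g : ℕ → ℕ} (hf : IsPolynomial f) (hg : IsPolynomial g) :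
    IsPolynomial fun n => f n * g n := by
  obtain ⟨p, hp⟩ := hf
  obtain ⟨q, hq⟩ := hg
  exact ⟨p * q, fun n => by rw [Polynomial.eval_mul, hp, hq]⟩

theorem isPolynomial_const (c : ℕ) : IsPolynomial fun _ => c :=
  ⟨Polynomial.C c, fun _ => Polynomial.eval_C⟩

theorem isPolynomial_id : IsPolynomial fun n => n :=
  ⟨Polynomial.X, fun _ => Polynomial.eval_X⟩

theorem isPolynomial_equalCardTime : IsPolynomial fun n => equalCardTime n + 6 := by
  unfold equalCardTime refineTime roundTime sideTime rowTime countsTime digitsTime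
  repeat' first
    | exact isPolynomial_id
    | exact isPolynomial_const _
    | refine IsPolynomial.add ?_ ?_
    | refine IsPolynomial.mul ?_ ?_

/-- The running time is bounded in terms of `n` alone, while the polynomial is evaluated at `n + m`.
-/
theorem equalCardTime_mono : Monotone equalCardTime := by
  intro a b hab
  unfold equalCardTime refineTime roundTime sideTime rowTime countsTime digitsTime
  gcongr

theorem polyTimeDecidable_graphEquivalent :
    PolyTimeDecidable fun X Y => GraphEquivalent X Y := by
  obtain ⟨p, hp⟩ := isPolynomial_equalCardTime
  refine ⟨equivalentProg, p, fun n m X Y => ?_⟩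
  obtain ⟨t, s, h1, h2, h3⟩ := exec_equivalentProg X Y
  refine ⟨t, s, h1, h2.trans ?_, h3⟩
  rw [hp]
  exact Nat.add_le_add_right (equalCardTime_mono (Nat.le_add_right n m)) 6

end Program

end QIso

theorem corollary4p9 :
    (∀ (V : Type u) (W : Type v) [Fintype V] [DecidableEq V] [Fintype W] [DecidableEq W]
      (X : SimpleGraph V) (Y : SimpleGraph W),
      QIso.QuantumIsomorphic.{u, v, w} X Y → QIso.GraphEquivalent X Y) ∧
    QIso.PolyTimeDecidable (fun X Y => QIso.GraphEquivalent X Y) :=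
  ⟨fun _ _ _ _ _ _ _ _ => QIso.graphEquivalent_of_quantumIsomorphic,
    QIso.polyTimeDecidable_graphEquivalent⟩
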